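/- Let $D>0$, $R>\sqrt3\,D$, and let $A\not\equiv 0$ be a smooth non-negative function on $\mathbb{R}^3$ supported in $[-D,D]^3$. Write $g_{\mathbb{E}}$ for the Euclidean metric, $B(p,r)$ for open Euclidean balls, and equip a set $U\subseteq\mathbb{R}^3$ carrying a Riemannian metric $g$ with the distance $d_{(U,g)}(x,y)$ defined as the infimum of the $g$-lengths of piecewise smooth paths in $U$ from $x$ to $y$. The Gromov–Hausdorff distance of two metric spaces is the infimum, over all distance-preserving embeddings of both into a common metric space, of the Hausdorff distance of the images. There is a unique $\chi\in C^2(\mathbb{R}^3)$ with $\Delta_{g_{\mathbb{E}}}\chi=-4\pi A$ and $\chi(x)\to 1$ as $|x|\to\infty$; it is smooth and positive. For $n\ge1$ let $p_{i,n}$ be the centers of the $(2n)^3$ boxes of side $D/n$ subdividing $[-D,D]^3$, and let $$\mathcal{U}_{n,R}=B(0,R)\smallsetminus\bigcup_i B\bigl(p_{i,n},\tfrac{D}{n^2}\bigr).$$ There are numbers $\alpha_{i,n}\ge 0$ with $\sup_{i,n} n^4\,|\alpha_{i,n}-A(p_{i,n})(D/n)^3|<\infty$ such that, for $$\chi_n(x)=1+\sum_i\frac{\alpha_{i,n}}{|x-p_{i,n}|},\qquad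 g_n=\chi_n^4\,g_{\mathbb{E}}$$ (a Brill–Lindquist–Riemann sum with no charge), every space $(\mathcal{U}_{n,R},g_n)$, $n\ge 1$, is scalar-flat, and, as $n\to\infty$, $(\mathcal{U}_{n,R},g_n)$ converges in the Gromov–Hausdorff sense to $(B(0,R),\chi^4g_{\mathbb{E}})$. The limit metric has scalar curvature $$\mathrm{Scal}(\chi^4g_{\mathbb{E}})=32\pi\,\chi^{-5}A\quad\text{on }B(0,R),$$ which is not identically zero on $B(0,R)$. -/

import Mathlib

open Filter Topology
open scoped ContDiff

noncomputable section

namespace BLR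

/-- Euclidean three-space. -/
abbrev E3 : Type := EuclideanSpace ℝ (Fin 3)

/-! ### Riemannian metrics on subsets of three-space, in the standard coordinates -/

/-- A field of `3 × 3` matrices `(g_ij)`: the components of a metric tensor. -/
abbrev MetricField : Type := E3 → Matrix (Fin 3) (Fin 3) ℝ

/-- The conformally flat metric `f · g_E`, where `g_E` is the Euclidean metric. -/
def conformal (f : E3 → ℝ) : MetricField := fun x => f x • (1 : Matrix (Fin 3) (Fin 3) ℝ)

/-- The partial derivative `∂_i f`. -/
def pd (i : Fin 3) (f : E3 → ℝ) (x : E3) : ℝ :=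
  fderiv ℝ f x (EuclideanSpace.single i 1)

/-- The Christoffel symbols
`Γ^k_ij = ½ ∑_l g^{kl} (∂_i g_jl + ∂_j g_il - ∂_l g_ij)`. -/
def christoffel (g : MetricField) (k i j : Fin 3) (x : E3) : ℝ :=
  (1 / 2) * ∑ l, (g x)⁻¹ k l *
    (pd i (fun y => g y j l) x + pd j (fun y => g y i l) x - pd l (fun y => g y i j) x)

/-- The Ricci tensor
`R_ij = ∑_k (∂_k Γ^k_ij - ∂_j Γ^k_ik) + ∑_{k,l} (Γ^k_kl Γ^l_ij - Γ^k_jl Γ^l_ik)`. -/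
def ricci (g : MetricField) (i j : Fin 3) (x : E3) : ℝ :=
  (∑ k, (pd k (christoffel g k i j) x - pd j (christoffel g k i k) x)) +
    ∑ k, ∑ l, (christoffel g k k l x * christoffel g l i j x -
      christoffel g k j l x * christoffel g l i k x)

/-- The scalar curvature `∑_{i,j} g^{ij} R_ij`. -/
def scalarCurvature (g : MetricField) (x : E3) : ℝ :=
  ∑ i, ∑ j, (g x)⁻¹ i j * ricci g i j x

/-- `γ` is piecewise smooth on `[0,1]`: it is continuous there, and for some finite set of break
points it is smooth (up to the end points) on every closed subinterval of `[0,1]` that has no break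
point in its interior. -/
def IsPiecewiseSmooth (γ : ℝ → E3) : Prop :=
  ContinuousOn γ (Set.Icc 0 1) ∧
    ∃ P : Finset ℝ, ∀ a b : ℝ, 0 ≤ a → a < b → b ≤ 1 → (∀ p ∈ P, p ∉ Set.Ioo a b) →
      ContDiffOn ℝ ∞ γ (Set.Icc a b)

/-- The `g`-length of `γ` on `[0,1]`. -/
def pathLength (g : MetricField) (γ : ℝ → E3) : ENNReal :=
  ∫⁻ t in Set.Icc (0 : ℝ) 1,
    ENNReal.ofReal (Real.sqrt (∑ i, ∑ j, g (γ t) i j * deriv γ t i * deriv γ t j))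

/-- The distance `d_(U,g)` of the space `(U, g)`: the infimum of the `g`-lengths of the piecewise
smooth paths that stay in `U` and join the two points. -/
def riemannianDist (U : Set E3) (g : MetricField) (x y : U) : ENNReal :=
  ⨅ (γ : ℝ → E3) (_ : IsPiecewiseSmooth γ ∧ (∀ t ∈ Set.Icc (0 : ℝ) 1, γ t ∈ U) ∧
    γ 0 = x ∧ γ 1 = y), pathLength g γ

/-! ### Gromov-Hausdorff distance -/

/-- The Gromov-Hausdorff distance of the spaces `(X, dX)` and `(Y, dY)`: the infimum, over all
metric isometric embeddings into a common metric space `Z`, of the Hausdorff distance of the images.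
Compactness is not required. If `dX` or `dY` is not a (finite) metric, there is no such embedding
and the value is `⊤`. -/
def gromovHausdorffEDist {X Y : Type} (dX : X → X → ENNReal) (dY : Y → Y → ENNReal) : ENNReal :=
  ⨅ (Z : Type) (_ : MetricSpace Z) (Φ : X → Z) (Ψ : Y → Z)
    (_ : ∀ p q, edist (Φ p) (Φ q) = dX p q) (_ : ∀ p q, edist (Ψ p) (Ψ q) = dY p q),
    Metric.hausdorffEDist (Set.range Φ) (Set.range Ψ)

/-! ### Potentials and Brill-Lindquist-Riemann sums -/

/-- The box `[-D, D]³`. -/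
def box (D : ℝ) : Set E3 := {x | ∀ k, x k ∈ Set.Icc (-D) D}

/-- `χ` is a (twice continuously differentiable) solution of `Δχ = -4πA` on three-space with
`χ → 1` at infinity. -/
def IsPotential (A χ : E3 → ℝ) : Prop :=
  ContDiff ℝ 2 χ ∧ (∀ x, Laplacian.laplacian χ x = -4 * Real.pi * A x) ∧
    Tendsto χ (cocompact E3) (𝓝 1)

/-- Labels of the `(2n)³` boxes of side `D/n` that subdivide `[-D, D]³`. -/
abbrev BoxIndex (n : ℕ) : Type := Fin 3 → Fin (2 * n)

/-- The center of a subdivision box: its `k`-th coordinate is `((i_k - n) + 1/2) D / n`, where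
`i_k - n` ranges over `-n, …, n - 1`. -/
def center (D : ℝ) (n : ℕ) (i : BoxIndex n) : E3 :=
  WithLp.toLp 2 fun k => ((((i k : ℕ) : ℝ) - n) + 1 / 2) / n * D

/-- The function `1 + ∑_i α_i / |x - p_i|`, with `p_i` the centers of the boxes. -/
def discretePotential (D : ℝ) (n : ℕ) (α : BoxIndex n → ℝ) (x : E3) : ℝ :=
  1 + ∑ i, α i / ‖x - center D n i‖

/-- The Brill-Lindquist metric `(χ_n ψ_n)² g_E` with parameters `α` (for `χ_n`) and `β`
(for `ψ_n`) at the centers of the boxes. -/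
def brillLindquistMetric (D : ℝ) (n : ℕ) (α β : BoxIndex n → ℝ) : MetricField :=
  conformal fun x => (discretePotential D n α x * discretePotential D n β x) ^ 2

/-- `α` is an admissible family of parameters of a Brill-Lindquist-Riemann sum for the density `A`:
`α_{i,n} ≥ 0` and `sup_{i,n} n⁴ |α_{i,n} - A(p_{i,n}) (D/n)³| < ∞`. -/
def IsAdmissible (D : ℝ) (A : E3 → ℝ) (α : (n : ℕ) → BoxIndex n → ℝ) : Prop :=
  (∀ n i, 0 ≤ α n i) ∧
    ∃ C : ℝ, ∀ n : ℕ, 1 ≤ n → ∀ i : BoxIndex n,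
      (n : ℝ) ^ 4 * |α n i - A (center D n i) * (D / n) ^ 3| ≤ C

/-- The set `U_{n,R}`: the open ball `B(0,R)` without the open balls of radius `D/n²` about the
centers of the boxes. -/
def perforatedBall (D R : ℝ) (n : ℕ) : Set E3 :=
  Metric.ball 0 R \ ⋃ i : BoxIndex n, Metric.ball (center D n i) (D / (n : ℝ) ^ 2)

end BLR

end

/-! The scalar curvature of χ⁴g_E is -8χ⁻⁵Δχ (`scalarCurvature_conformal_pow_four`). Hence χ_n,
harmonic off the centers, gives a scalar-flat metric, and Δχ = -4πA gives the curvature of the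
limit. The potential is χ = 1 + |x|⁻¹ * A: the Poisson equation follows by regularizing the kernel
(`laplacian_newtonConv`), uniqueness from the maximum principle (`IsPotential.unique`).

With the weights A(p)(D/n)³, χ_n - 1 is a Riemann sum for the Newton potential. The kernel is
singular, but outside the holes |x - p|⁻¹ is at most n²/D, and only boxes within O(1/n) of x, of
total volume O(n⁻³), feel this size. The error is O(1/n), uniformly off the holes
(`abs_newtonConv_sub_sum_le`).

It remains to see that the holes do not lengthen distances in the limit. One inequality is free: a
path in the perforated ball is a path in the ball. Conversely, a path of length at most L is covered
by about Ln²/D balls of the hole radius D/n². The translations that push it into a hole lie in about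
(2n)³ · Ln²/D balls of radius 2D/n², of total volume O(1/n). So some small translation, after a
slight shrinking that keeps the path in B(0,R), misses every hole (`exists_translate_notMem_holes`,
`eventually_exists_translate`). The displaced endpoints are joined to the original ones by short
detours along the grid planes, which no hole meets (`riemannianDist_perforatedBall_le`). The
inclusion is then almost isometric with almost dense image, and `gromovHausdorffEDist_le` concludes.
-/

noncomputable section

namespace BLR

/-! ### Partial derivatives and curvature of conformally flat metrics -/

theorem pd_congr {f g : E3 → ℝ} {x : E3} (i : Fin 3) (h : f =ᶠ[𝓝 x] g) : pd i f x = pd i g x := by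
  simp only [pd, h.fderiv_eq]

theorem pd_mul_const {f : E3 → ℝ} {x : E3} (i : Fin 3) (c : ℝ) :
    pd i (fun y => f y * c) x = pd i f x * c := by
  by_cases hc : c = 0
  · simp [pd, hc]
  have : (fun y => f y * c) = c • f := by ext; simp [mul_comm]
  rw [pd, this, fderiv_const_smul_field, pd]
  simp [mul_comm]

theorem pd_add {f g : E3 → ℝ} {x : E3} (i : Fin 3) (hf : DifferentiableAt ℝ f x)
    (hg : DifferentiableAt ℝ g x) : pd i (fun y => f y + g y) x = pd i f x + pd i g x := by
  simp [pd, fderiv_fun_add hf hg]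

theorem pd_sub {f g : E3 → ℝ} {x : E3} (i : Fin 3) (hf : DifferentiableAt ℝ f x)
    (hg : DifferentiableAt ℝ g x) : pd i (fun y => f y - g y) x = pd i f x - pd i g x := by
  simp [pd, fderiv_fun_sub hf hg]

theorem pd_mul {f g : E3 → ℝ} {x : E3} (i : Fin 3) (hf : DifferentiableAt ℝ f x)
    (hg : DifferentiableAt ℝ g x) :
    pd i (fun y => f y * g y) x = pd i f x * g x + f x * pd i g x := by
  simp [pd, fderiv_fun_mul hf hg]; ring

/-- The chain rule for a function of one variable. -/
theorem pd_comp {f : E3 → ℝ} {x : E3} (i : Fin 3) {φ : ℝ → ℝ} {φ' : ℝ}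
    (hφ : HasDerivAt φ φ' (f x)) (hf : DifferentiableAt ℝ f x) :
    pd i (fun y => φ (f y)) x = φ' * pd i f x := by
  have := (hφ.comp_hasFDerivAt x hf.hasFDerivAt).fderiv
  simp only [pd]
  change fderiv ℝ (φ ∘ f) x _ = _
  rw [this]; simp

theorem contDiffAt_pd {f : E3 → ℝ} {x : E3} {m n : WithTop ℕ∞} (hf : ContDiffAt ℝ n f x)
    (h : m + 1 ≤ n) (i : Fin 3) : ContDiffAt ℝ m (pd i f) x :=
  (hf.fderiv_right h).clm_apply contDiffAt_const

theorem pd_pd_eq {f : E3 → ℝ} {x : E3} (hf : ContDiffAt ℝ 2 f x) (i j : Fin 3) :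
    pd i (pd j f) x =
      fderiv ℝ (fderiv ℝ f) x (EuclideanSpace.single i 1) (EuclideanSpace.single j 1) := by
  have h : DifferentiableAt ℝ (fderiv ℝ f) x :=
    (hf.fderiv_right (m := 1) (by norm_num)).differentiableAt (by norm_num)
  rw [pd]
  change fderiv ℝ (fun y => fderiv ℝ f y _) x _ = _
  rw [fderiv_clm_apply h (differentiableAt_const _)]
  simp

theorem pd_pd_comm {f : E3 → ℝ} {x : E3} (hf : ContDiffAt ℝ 2 f x) (i j : Fin 3) :
    pd i (pd j f) x = pd j (pd i f) x := by
  rw [pd_pd_eq hf, pd_pd_eq hf]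
  exact (hf.isSymmSndFDerivAt (by simp)).eq _ _

theorem laplacian_eq_sum_pd {f : E3 → ℝ} {x : E3} (hf : ContDiffAt ℝ 2 f x) :
    Laplacian.laplacian f x = ∑ i, pd i (pd i f) x := by
  rw [InnerProductSpace.laplacian_eq_iteratedFDeriv_orthonormalBasis f
    (EuclideanSpace.basisFun (Fin 3) ℝ)]
  refine Finset.sum_congr rfl fun i _ => ?_
  rw [pd_pd_eq hf, iteratedFDeriv_two_apply]
  simp

theorem conformal_apply (f : E3 → ℝ) (x : E3) (i j : Fin 3) :
    conformal f x i j = f x * if i = j then 1 else 0 := by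
  simp [conformal, Matrix.one_apply]

theorem conformal_inv_apply (f : E3 → ℝ) (x : E3) (i j : Fin 3) :
    (conformal f x)⁻¹ i j = (f x)⁻¹ * if i = j then 1 else 0 := by
  have : (conformal f x)⁻¹ = (f x)⁻¹ • (1 : Matrix (Fin 3) (Fin 3) ℝ) := by
    by_cases h : f x = 0
    · simp [conformal, h]
    · apply Matrix.inv_eq_left_inv
      simp [conformal, smul_smul, h]
  simp [this, Matrix.one_apply]

theorem christoffel_conformal {χ : E3 → ℝ} {x : E3} (hχ : DifferentiableAt ℝ χ x) (h0 : χ x ≠ 0)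
    (k i j : Fin 3) :
    christoffel (conformal fun y => χ y ^ 4) k i j x =
      pd i χ x * (χ x)⁻¹ * (if j = k then 2 else 0) + pd j χ x * (χ x)⁻¹ * (if i = k then 2 else 0)
        - pd k χ x * (χ x)⁻¹ * (if i = j then 2 else 0) := by
  have hp : ∀ m, pd m (fun y => χ y ^ 4) x = 4 * χ x ^ 3 * pd m χ x := fun m => by
    rw [pd_comp m (φ := fun t => t ^ 4) (hasDerivAt_pow 4 _) hχ]; norm_num
  simp only [christoffel, conformal_inv_apply, conformal_apply, pd_mul_const, hp]
  simp only [mul_ite, mul_one,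
    mul_zero, ite_mul, zero_mul, Finset.sum_ite_eq, Finset.mem_univ, if_true]
  split_ifs <;> field_simp <;> ring

theorem pd_christoffel_conformal {χ : E3 → ℝ} {x : E3} (hχ : ContDiffAt ℝ 2 χ x) (h0 : χ x ≠ 0)
    (m k i j : Fin 3) :
    pd m (christoffel (conformal fun y => χ y ^ 4) k i j) x =
      (pd m (pd i χ) x * (χ x)⁻¹ - pd i χ x * pd m χ x * ((χ x)⁻¹) ^ 2) * (if j = k then 2 else 0) +
      (pd m (pd j χ) x * (χ x)⁻¹ - pd j χ x * pd m χ x * ((χ x)⁻¹) ^ 2) * (if i = k then 2 else 0) -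
      (pd m (pd k χ) x * (χ x)⁻¹ - pd k χ x * pd m χ x * ((χ x)⁻¹) ^ 2) *
        (if i = j then 2 else 0) := by
  have hd : DifferentiableAt ℝ χ x := hχ.differentiableAt (by norm_num)
  have hp : ∀ l, DifferentiableAt ℝ (pd l χ) x := fun l =>
    (contDiffAt_pd hχ (m := 1) (by norm_num) l).differentiableAt (by norm_num)
  have hi : DifferentiableAt ℝ (fun y => (χ y)⁻¹) x := hd.inv h0
  have hq : ∀ l, DifferentiableAt ℝ (fun y => pd l χ y * (χ y)⁻¹) x := fun l => (hp l).mul hi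
  have hdq : ∀ l, pd m (fun y => pd l χ y * (χ y)⁻¹) x =
      pd m (pd l χ) x * (χ x)⁻¹ - pd l χ x * pd m χ x * ((χ x)⁻¹) ^ 2 := fun l => by
    rw [pd_mul m (hp l) hi, pd_comp m (φ := fun t => t⁻¹) (hasDerivAt_inv h0) hd]
    simp only [inv_pow]; ring
  have hev : christoffel (conformal fun y => χ y ^ 4) k i j =ᶠ[𝓝 x] fun y =>
      pd i χ y * (χ y)⁻¹ * (if j = k then 2 else 0) + pd j χ y * (χ y)⁻¹ * (if i = k then 2 else 0)
        - pd k χ y * (χ y)⁻¹ * (if i = j then 2 else 0) := by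
    filter_upwards [hχ.eventually (by simp), hd.continuousAt.eventually_ne h0] with y hy hy0
    exact christoffel_conformal (hy.differentiableAt (by norm_num)) hy0 k i j
  rw [pd_congr m hev, pd_sub m (((hq i).mul_const _).fun_add ((hq j).mul_const _)) ((hq k).mul_const _),
    pd_add m ((hq i).mul_const _) ((hq j).mul_const _)]
  simp only [pd_mul_const, hdq]

/-- The scalar curvature of `χ⁴ g_E` is `-8 χ⁻⁵ Δχ`. -/
theorem scalarCurvature_conformal_pow_four {χ : E3 → ℝ} {x : E3} (hχ : ContDiffAt ℝ 2 χ x)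
    (h0 : χ x ≠ 0) :
    scalarCurvature (conformal fun y => χ y ^ 4) x =
      -8 * (χ x ^ 5)⁻¹ * Laplacian.laplacian χ x := by
  have hd : DifferentiableAt ℝ χ x := hχ.differentiableAt (by norm_num)
  rw [laplacian_eq_sum_pd hχ]
  simp only [scalarCurvature, ricci, conformal_inv_apply, pd_christoffel_conformal hχ h0,
    christoffel_conformal hd h0]
  -- Symmetry of second derivatives leaves one representative of each mixed pair, so that `ring` can
  -- close the remaining polynomial identity.
  have h10 := pd_pd_comm hχ 1 0
  have h20 := pd_pd_comm hχ 2 0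
  have h21 := pd_pd_comm hχ 2 1
  simp only [Fin.sum_univ_three, h10, h20, h21, Fin.isValue, if_true, if_false, mul_zero, mul_one,
    zero_ne_one, one_ne_zero, add_zero, zero_add, sub_zero, zero_sub, zero_mul,
    show (2 : Fin 3) ≠ 0 by decide, show (2 : Fin 3) ≠ 1 by decide, show (0 : Fin 3) ≠ 2 by decide,
    show (1 : Fin 3) ≠ 2 by decide]
  field_simp
  ring

/-! ### The maximum principle -/

theorem hasDerivAt_line {f : E3 → ℝ} (i : Fin 3) (x : E3) (t : ℝ)
    (hf : DifferentiableAt ℝ f (x + t • EuclideanSpace.single i 1)) :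
    HasDerivAt (fun s : ℝ => f (x + s • EuclideanSpace.single i 1))
      (pd i f (x + t • EuclideanSpace.single i 1)) t := by
  have h1 : HasDerivAt (fun s : ℝ => x + s • (EuclideanSpace.single i 1 : E3))
      (EuclideanSpace.single i 1) t := by
    simpa using ((hasDerivAt_id t).smul_const (EuclideanSpace.single i (1 : ℝ) : E3)).const_add x
  exact hf.hasFDerivAt.comp_hasDerivAt t h1

/-- A positive second derivative would make the point also a local minimum along the line; the
restriction would be locally constant, with second derivative zero. -/
theorem pd_pd_nonpos_of_isLocalMax {f : E3 → ℝ} {x : E3} (hf : ContDiff ℝ 2 f)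
    (hx : IsLocalMax f x) (i : Fin 3) : pd i (pd i f) x ≤ 0 := by
  by_contra! hpos
  set g : ℝ → ℝ := fun s => f (x + s • EuclideanSpace.single i 1) with hg
  have hd1 : ∀ t, HasDerivAt g (pd i f (x + t • EuclideanSpace.single i 1)) t := fun t =>
    hasDerivAt_line i x t (hf.differentiable (by norm_num) _)
  have hdg : deriv g = fun t : ℝ => pd i f (x + t • EuclideanSpace.single i 1) :=
    funext fun t => (hd1 t).deriv
  have hpdf : Differentiable ℝ (pd i f) := fun y =>
    (contDiffAt_pd (m := 1) hf.contDiffAt (by norm_num) i).differentiableAt (by norm_num)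
  have hd2 : deriv (deriv g) 0 = pd i (pd i f) x := by
    rw [hdg, (hasDerivAt_line i x 0 (hpdf _)).deriv]; simp
  have hcont : Continuous fun s : ℝ => x + s • (EuclideanSpace.single i 1 : E3) := by fun_prop
  have hmax : IsLocalMax g 0 := by
    have : Tendsto (fun s : ℝ => x + s • (EuclideanSpace.single i 1 : E3)) (𝓝 0) (𝓝 x) := by
      simpa using hcont.tendsto 0
    filter_upwards [this.eventually hx] with s hs
    simpa [hg] using hs
  have hmin : IsLocalMin g 0 := isLocalMin_of_deriv_deriv_pos (hd2 ▸ hpos) hmax.deriv_eq_zero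
    (hd1 0).continuousAt
  have hconst : g =ᶠ[𝓝 0] fun _ => g 0 := by
    filter_upwards [hmax, hmin] with s h1 h2 using le_antisymm h1 h2
  have h0 : deriv (deriv g) 0 = 0 := by
    rw [(hconst.deriv).deriv_eq]; simp
  rw [hd2] at h0
  exact hpos.ne' h0

theorem pd_norm_sub_sq (i : Fin 3) (p x : E3) :
    pd i (fun y => ‖y - p‖ ^ 2) x = 2 * (x i - p i) := by
  have h : HasFDerivAt (fun y : E3 => ‖y - p‖ ^ 2) _ x :=
    ((hasFDerivAt_id x).sub_const p).norm_sq
  rw [pd, h.fderiv]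
  simp [EuclideanSpace.inner_single_right]

theorem contDiff_norm_sub_sq (p : E3) {n : WithTop ℕ∞} :
    ContDiff ℝ n fun y : E3 => ‖y - p‖ ^ 2 :=
  (contDiff_id.sub contDiff_const).norm_sq ℝ

theorem pd_const (i : Fin 3) (c : ℝ) (x : E3) : pd i (fun _ => c) x = 0 := by simp [pd]

theorem pd_coord_sub (i : Fin 3) (p x : E3) : pd i (fun y => y i - p i) x = 1 := by
  have h : HasFDerivAt (fun y : E3 => y i - p i) (EuclideanSpace.proj i : E3 →L[ℝ] ℝ) x :=
    (EuclideanSpace.proj (𝕜 := ℝ) i : E3 →L[ℝ] ℝ).hasFDerivAt.sub_const (p i)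
  rw [pd, h.fderiv]; simp

theorem pd_norm_sub_sq_pd (i : Fin 3) (p x : E3) :
    pd i (pd i fun y => ‖y - p‖ ^ 2) x = 2 := by
  have : (pd i fun y => ‖y - p‖ ^ 2) = fun x => (x i - p i) * 2 := by
    ext x; rw [pd_norm_sub_sq]; ring
  rw [this, pd_mul_const, pd_coord_sub]; ring

/-- A harmonic function on three-space that vanishes at infinity is nowhere positive. -/
theorem nonpos_of_laplacian_eq_zero {u : E3 → ℝ} (hu : ContDiff ℝ 2 u)
    (hΔ : ∀ x, Laplacian.laplacian u x = 0) (hlim : Tendsto u (cocompact E3) (𝓝 0)) (x : E3) :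
    u x ≤ 0 := by
  by_contra! hx
  obtain ⟨ρ, hρ⟩ : ∃ ρ, ∀ y : E3, ρ < ‖y‖ → u y < u x / 2 := by
    have := hlim.eventually (gt_mem_nhds (half_pos hx))
    rw [← Metric.cobounded_eq_cocompact, ← comap_norm_atTop, ((atTop_basis_Ioi (α := ℝ)).comap _).eventually_iff] at this
    obtain ⟨ρ, -, h⟩ := this
    exact ⟨ρ, fun y hy => h hy⟩
  set r := max ρ ‖x‖ + 1
  have hr : 0 < r := by have := norm_nonneg x; have := le_max_right ρ ‖x‖; linarith
  have hxr : ‖x‖ < r := by have := le_max_right ρ ‖x‖; linarith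
  have hρr : ρ < r := by have := le_max_left ρ ‖x‖; linarith
  -- Adding ε|y|² makes u strictly subharmonic, at the cost of only u(x)/2 on the sphere of radius
  -- r, where u itself is below u(x)/2. So the maximum over the ball is interior, although the
  -- second derivatives there sum to 6ε > 0.
  set ε := u x / 2 / r ^ 2
  have hε : 0 < ε := by positivity
  have hεr : ε * r ^ 2 = u x / 2 := by simp only [ε]; field_simp
  set v : E3 → ℝ := fun y => u y + ‖y - 0‖ ^ 2 * ε with hv
  have hv2 : ContDiff ℝ 2 v := hu.add ((contDiff_norm_sub_sq 0).mul contDiff_const)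
  obtain ⟨z, hz, hzmax⟩ := (isCompact_closedBall (0 : E3) r).exists_isMaxOn
    ⟨0, by simp [hr.le]⟩ hv2.continuous.continuousOn
  have hvx : v x ≤ v z := hzmax (by simpa using hxr.le)
  have hzr : ‖z‖ < r := by
    refine lt_of_le_of_ne (by simpa using hz) fun h => ?_
    have h1 : u z < u x / 2 := hρ z (h ▸ hρr)
    have h2 : v z < u x := by
      simp only [hv, sub_zero, h]; linarith
    have h3 : u x ≤ v x := by simp only [hv]; have := sq_nonneg ‖x - 0‖; nlinarith
    linarith
  have hloc : IsLocalMax v z := by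
    have hzb : z ∈ Metric.ball 0 r := by simpa using hzr
    exact hzmax.isLocalMax (Filter.mem_of_superset (Metric.isOpen_ball.mem_nhds hzb)
      Metric.ball_subset_closedBall)
  have hd : ∀ i, pd i (pd i v) z = pd i (pd i u) z + 2 * ε := fun i => by
    have hn : ∀ y, DifferentiableAt ℝ (fun y : E3 => ‖y - 0‖ ^ 2) y := fun y =>
      (contDiff_norm_sub_sq (n := 1) 0).differentiable (by norm_num) y
    have h1 : pd i v = fun y => pd i u y + pd i (fun y => ‖y - 0‖ ^ 2) y * ε := by
      ext y
      rw [hv, pd_add i (hu.differentiable (by norm_num) y) ((hn y).mul_const _), pd_mul_const]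
    have hn2 : DifferentiableAt ℝ (pd i (fun y : E3 => ‖y - 0‖ ^ 2)) z :=
      (contDiffAt_pd (m := 1) (n := 2) (contDiff_norm_sub_sq 0).contDiffAt (by norm_num)
        i).differentiableAt (by norm_num)
    rw [h1, pd_add i ((contDiffAt_pd (m := 1) hu.contDiffAt (by norm_num)
      i).differentiableAt (by norm_num)) (hn2.mul_const _), pd_mul_const, pd_norm_sub_sq_pd]
  have h6 : ∑ i, pd i (pd i v) z = 6 * ε := by
    simp only [hd, Finset.sum_add_distrib, ← laplacian_eq_sum_pd hu.contDiffAt, hΔ]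
    simp; ring
  have : ∑ i, pd i (pd i v) z ≤ 0 :=
    Finset.sum_nonpos fun i _ => pd_pd_nonpos_of_isLocalMax hv2 hloc i
  linarith

theorem IsPotential.unique {A χ₁ χ₂ : E3 → ℝ} (h₁ : IsPotential A χ₁) (h₂ : IsPotential A χ₂) :
    χ₁ = χ₂ := by
  have key : ∀ {χ₁ χ₂ : E3 → ℝ}, IsPotential A χ₁ → IsPotential A χ₂ → ∀ x, χ₁ x ≤ χ₂ x := by
    intro χ₁ χ₂ h₁ h₂ x
    have := nonpos_of_laplacian_eq_zero (h₁.1.sub h₂.1) (fun y => ?_)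
      (by simpa using h₁.2.2.sub h₂.2.2) x
    · simpa using this
    · have := h₁.1.contDiffAt.laplacian_sub (x := y) h₂.1.contDiffAt
      rw [h₁.2.1, h₂.2.1, sub_self] at this
      exact this
  exact funext fun x => le_antisymm (key h₁ h₂ x) (key h₂ h₁ x)

/-! ### The regularized Newton kernel -/

/-- The kernel `(|x - p|² + e)^(-1/2)`, which is the Newton kernel if `e = 0`. -/
def newtonKernel (e : ℝ) (p x : E3) : ℝ := (‖x - p‖ ^ 2 + e) ^ (-1 / 2 : ℝ)

theorem newtonKernel_zero (p x : E3) : newtonKernel 0 p x = ‖x - p‖⁻¹ := by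
  rw [newtonKernel, add_zero, ← Real.rpow_natCast, ← Real.rpow_mul (norm_nonneg _)]
  norm_num [Real.rpow_neg_one]

theorem contDiffAt_rpow_norm_sub_sq_add {e : ℝ} {p x : E3} (s : ℝ) (h : 0 < ‖x - p‖ ^ 2 + e)
    {n : WithTop ℕ∞} : ContDiffAt ℝ n (fun y => (‖y - p‖ ^ 2 + e) ^ s) x :=
  ((contDiff_norm_sub_sq p).add contDiff_const).contDiffAt.rpow_const_of_ne h.ne'

theorem pd_rpow_norm_sub_sq_add {e : ℝ} {p x : E3} (s : ℝ) (h : 0 < ‖x - p‖ ^ 2 + e) (i : Fin 3) :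
    pd i (fun y => (‖y - p‖ ^ 2 + e) ^ s) x =
      2 * s * (‖x - p‖ ^ 2 + e) ^ (s - 1) * (x i - p i) := by
  have hn : DifferentiableAt ℝ (fun y : E3 => ‖y - p‖ ^ 2) x :=
    (contDiff_norm_sub_sq (n := 1) p).differentiable (by norm_num) x
  rw [pd_comp i (φ := fun t => t ^ s) (Real.hasDerivAt_rpow_const (Or.inl h.ne'))
    (hn.add_const e), pd_add i hn (differentiableAt_const _), pd_norm_sub_sq, pd_const]
  ring

theorem pd_newtonKernel {e : ℝ} {p x : E3} (h : 0 < ‖x - p‖ ^ 2 + e) (i : Fin 3) :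
    pd i (newtonKernel e p) x = -((‖x - p‖ ^ 2 + e) ^ (-3 / 2 : ℝ) * (x i - p i)) := by
  change pd i (fun y => (‖y - p‖ ^ 2 + e) ^ (-1 / 2 : ℝ)) x = _
  rw [pd_rpow_norm_sub_sq_add _ h]
  norm_num

theorem pd_pd_newtonKernel {e : ℝ} {p x : E3} (h : 0 < ‖x - p‖ ^ 2 + e) (i : Fin 3) :
    pd i (pd i (newtonKernel e p)) x =
      3 * (‖x - p‖ ^ 2 + e) ^ (-5 / 2 : ℝ) * (x i - p i) ^ 2
        - (‖x - p‖ ^ 2 + e) ^ (-3 / 2 : ℝ) := by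
  have hev : pd i (newtonKernel e p) =ᶠ[𝓝 x]
      fun y => ((‖y - p‖ ^ 2 + e) ^ (-3 / 2 : ℝ) * (y i - p i)) * (-1) := by
    have hc : ContinuousAt (fun y : E3 => ‖y - p‖ ^ 2 + e) x := by fun_prop
    filter_upwards [hc.eventually (lt_mem_nhds h)] with y hy
    rw [pd_newtonKernel hy]; ring
  have hd : DifferentiableAt ℝ (fun y : E3 => (‖y - p‖ ^ 2 + e) ^ (-3 / 2 : ℝ)) x :=
    (contDiffAt_rpow_norm_sub_sq_add (n := 1) _ h).differentiableAt (by norm_num)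
  have hx : DifferentiableAt ℝ (fun y : E3 => y i - p i) x := by fun_prop
  rw [pd_congr i hev, pd_mul_const, pd_mul i hd hx, pd_rpow_norm_sub_sq_add _ h, pd_coord_sub]
  norm_num
  ring

theorem contDiffAt_newtonKernel {e : ℝ} {p x : E3} (h : 0 < ‖x - p‖ ^ 2 + e) {n : WithTop ℕ∞} :
    ContDiffAt ℝ n (newtonKernel e p) x := contDiffAt_rpow_norm_sub_sq_add _ h

/-- For e = ε² > 0 this is -ε⁻³ times a fixed integrable profile at (x - p)/ε, an approximation of
-4πδ_p. For e = 0 it is the harmonicity of the Newton kernel. -/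
theorem sum_pd_pd_newtonKernel {e : ℝ} {p x : E3} (h : 0 < ‖x - p‖ ^ 2 + e) :
    ∑ i, pd i (pd i (newtonKernel e p)) x = -3 * e * (‖x - p‖ ^ 2 + e) ^ (-5 / 2 : ℝ) := by
  simp only [pd_pd_newtonKernel h]
  have hs : ∑ i, (x i - p i) ^ 2 = ‖x - p‖ ^ 2 := by
    rw [EuclideanSpace.norm_sq_eq]; simp
  have h3 : (‖x - p‖ ^ 2 + e) ^ (-3 / 2 : ℝ) =
      (‖x - p‖ ^ 2 + e) ^ (-5 / 2 : ℝ) * (‖x - p‖ ^ 2 + e) := by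
    rw [← Real.rpow_add_one h.ne']; norm_num
  rw [Finset.sum_sub_distrib, ← Finset.mul_sum, hs, Finset.sum_const, h3]
  simp; ring

theorem contDiffAt_inv_norm_sub {p x : E3} (h : x ≠ p) {n : WithTop ℕ∞} :
    ContDiffAt ℝ n (fun y => ‖y - p‖⁻¹) x := by
  have := contDiffAt_newtonKernel (e := 0) (p := p) (x := x) (n := n)
    (by have := norm_pos_iff.2 (sub_ne_zero.2 h); positivity)
  simpa only [funext (newtonKernel_zero p)] using this

theorem laplacian_inv_norm_sub {p x : E3} (h : x ≠ p) :
    Laplacian.laplacian (fun y => ‖y - p‖⁻¹) x = 0 := by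
  rw [laplacian_eq_sum_pd (contDiffAt_inv_norm_sub h), ← funext (newtonKernel_zero p),
    sum_pd_pd_newtonKernel (by have := norm_pos_iff.2 (sub_ne_zero.2 h); positivity)]
  simp

/-! ### The Newton potential -/

open MeasureTheory

theorem finrank_E3 : Module.finrank ℝ E3 = 3 := by simp

theorem locallyIntegrable_inv_norm : LocallyIntegrable (fun y : E3 => ‖y‖⁻¹) :=
  locallyIntegrable_of_norm_le_rpow (C := 1) (α := 1) (by simp) (by simp)
    (ae_of_all _ fun x => by simp [Real.rpow_neg_one]) (by fun_prop)

theorem locallyIntegrable_inv_norm_sq : LocallyIntegrable (fun y : E3 => (‖y‖ ^ 2)⁻¹) :=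
  locallyIntegrable_of_norm_le_rpow (C := 1) (α := 2) (by simp) (by simp; norm_num)
    (ae_of_all _ fun x => by
      rw [Real.rpow_neg (norm_nonneg _), Real.rpow_two]; simp) (by fun_prop)

theorem LocallyIntegrable.comp_sub_left {f : E3 → ℝ} (hf : LocallyIntegrable f) (x : E3) :
    LocallyIntegrable fun y => f (x - y) := by
  rw [MeasureTheory.locallyIntegrable_iff] at hf ⊢
  intro K hK
  have h1 : IsCompact ((fun y => x - y) '' K) := hK.image (by fun_prop)
  have := hf _ h1
  have hm : MeasurePreserving (fun y : E3 => x - y) volume volume :=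
    Measure.measurePreserving_sub_left volume x
  have he : MeasurableEmbedding fun y : E3 => x - y :=
    (MeasurableEquiv.subLeft x).measurableEmbedding
  exact (hm.integrableOn_image he).1 this

/-- The convolution of a function with the Newton kernel. -/
def newtonConv (f : E3 → ℝ) (x : E3) : ℝ := ∫ y, ‖x - y‖⁻¹ * f y

theorem newtonConv_eq_convolution (f : E3 → ℝ) :
    newtonConv f =
      MeasureTheory.convolution (fun y : E3 => ‖y‖⁻¹) f (ContinuousLinearMap.mul ℝ ℝ) volume := by
  ext x
  rw [newtonConv, MeasureTheory.convolution_def,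
    ← integral_sub_left_eq_self (fun y => ‖x - y‖⁻¹ * f y) volume x]
  simp

theorem contDiff_newtonConv {f : E3 → ℝ} {n : ℕ∞} (hf : ContDiff ℝ n f)
    (hc : HasCompactSupport f) : ContDiff ℝ n (newtonConv f) := by
  rw [newtonConv_eq_convolution]
  exact hc.contDiff_convolution_right _ locallyIntegrable_inv_norm hf

theorem hasCompactSupport_pd {f : E3 → ℝ} (hc : HasCompactSupport f) (i : Fin 3) :
    HasCompactSupport (pd i f) :=
  (hc.fderiv ℝ).comp_left (g := fun L : E3 →L[ℝ] ℝ => L (EuclideanSpace.single i 1)) rfl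

theorem contDiff_pd {f : E3 → ℝ} {m n : WithTop ℕ∞} (hf : ContDiff ℝ n f)
    (h : m + 1 ≤ n) (i : Fin 3) : ContDiff ℝ m (pd i f) :=
  contDiff_iff_contDiffAt.2 fun _ => contDiffAt_pd hf.contDiffAt h i

/-- The derivative falls on the smooth factor, so local integrability of the kernel suffices. -/
theorem pd_newtonConv {f : E3 → ℝ} (hf : ContDiff ℝ 1 f) (hc : HasCompactSupport f) (i : Fin 3) :
    pd i (newtonConv f) = newtonConv (pd i f) := by
  ext x
  rw [pd, newtonConv_eq_convolution, newtonConv_eq_convolution,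
    (hc.hasFDerivAt_convolution_right (ContinuousLinearMap.mul ℝ ℝ) locallyIntegrable_inv_norm
      hf x).fderiv, convolution_precompR_apply _ locallyIntegrable_inv_norm (hc.fderiv ℝ)
      (hf.continuous_fderiv one_ne_zero)]
  rfl

theorem integral_mul_pd {f g : E3 → ℝ} (hf : ContDiff ℝ 1 f) (hg : ContDiff ℝ 1 g)
    (hc : HasCompactSupport g) (i : Fin 3) : ∫ y, f y * pd i g y = -∫ y, pd i f y * g y := by
  have hpf : Continuous (pd i f) := (contDiff_pd (m := 0) hf (by norm_num) i).continuous
  have hpg : Continuous (pd i g) := (contDiff_pd (m := 0) hg (by norm_num) i).continuous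
  exact integral_mul_fderiv_eq_neg_fderiv_mul_of_integrable
    ((hpf.mul hg.continuous).integrable_of_hasCompactSupport hc.mul_left)
    ((hf.continuous.mul hpg).integrable_of_hasCompactSupport (hasCompactSupport_pd hc i).mul_left)
    ((hf.continuous.mul hg.continuous).integrable_of_hasCompactSupport hc.mul_left)
    (fun x _ => hf.differentiable (by norm_num) x) (fun x _ => hg.differentiable (by norm_num) x)

theorem integral_mul_pd_pd {f g : E3 → ℝ} (hf : ContDiff ℝ 2 f) (hg : ContDiff ℝ 2 g)
    (hc : HasCompactSupport g) (i : Fin 3) :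
    ∫ y, f y * pd i (pd i g) y = ∫ y, pd i (pd i f) y * g y := by
  rw [integral_mul_pd (hf.of_le (by norm_num)) (contDiff_pd hg (by norm_num) i)
      (hasCompactSupport_pd hc i),
    integral_mul_pd (contDiff_pd hf (by norm_num) i) (hg.of_le (by norm_num)) hc, neg_neg]

/-! ### The regularized kernel as an approximate identity; Poisson equation and decay -/

theorem integral_bubble :
    ∫ z : E3, 3 * (‖z‖ ^ 2 + 1) ^ (-5 / 2 : ℝ) = 4 * Real.pi := by
  have hpos : ∀ r : ℝ, 0 < r ^ 2 + 1 := fun r => by positivity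
  -- In polar coordinates the radial density has the primitive r³(r² + 1)^(-3/2), which rises from 0
  -- to 1.
  have hder : ∀ r ∈ Set.Ici (0 : ℝ), HasDerivAt (fun r : ℝ => r ^ 3 * (r ^ 2 + 1) ^ (-3 / 2 : ℝ))
      (r ^ 2 * (3 * (r ^ 2 + 1) ^ (-5 / 2 : ℝ))) r := fun r _ => by
    have h1 : HasDerivAt (fun r : ℝ => r ^ 2 + 1) (2 * r) r := by
      simpa using (hasDerivAt_pow 2 r).add_const 1
    have h2 := (hasDerivAt_pow 3 r).fun_mul (h1.rpow_const (p := -3 / 2) (Or.inl (hpos r).ne'))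
    refine h2.congr_deriv ?_
    have h3 : (r ^ 2 + 1) ^ (-3 / 2 : ℝ) = (r ^ 2 + 1) ^ (-5 / 2 : ℝ) * (r ^ 2 + 1) := by
      rw [← Real.rpow_add_one (hpos r).ne']; norm_num
    rw [h3, show (-3 / 2 - 1 : ℝ) = -5 / 2 by norm_num]
    push_cast
    ring
  have hlim : Tendsto (fun r : ℝ => r ^ 3 * (r ^ 2 + 1) ^ (-3 / 2 : ℝ)) atTop (𝓝 1) := by
    have h1 : Tendsto (fun r : ℝ => (1 + (r ^ 2)⁻¹) ^ (-3 / 2 : ℝ)) atTop (𝓝 1) := by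
      have h2 : Tendsto (fun r : ℝ => 1 + (r ^ 2)⁻¹) atTop (𝓝 (1 + 0)) :=
        tendsto_const_nhds.add (tendsto_inv_atTop_zero.comp (tendsto_pow_atTop two_ne_zero))
      have := h2.rpow_const (p := -3 / 2) (Or.inl (by norm_num))
      simpa using this
    refine h1.congr' ?_
    filter_upwards [eventually_gt_atTop 0] with r hr
    rw [show r ^ 2 + 1 = r ^ 2 * (1 + (r ^ 2)⁻¹) by field_simp,
      Real.mul_rpow (by positivity) (by positivity), ← Real.rpow_natCast r 2,
      ← Real.rpow_mul hr.le, ← mul_assoc, ← Real.rpow_natCast r 3, ← Real.rpow_add hr]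
    norm_num
  have := integral_Ioi_of_hasDerivAt_of_nonneg' hder (fun r _ => by positivity) hlim
  rw [integral_fun_norm_addHaar volume fun r : ℝ => 3 * (r ^ 2 + 1) ^ (-5 / 2 : ℝ)]
  simp only [finrank_E3, smul_eq_mul, Nat.add_one_sub_one]
  rw [this, Measure.real, EuclideanSpace.volume_ball_fin_three]
  rw [ENNReal.toReal_mul, ENNReal.toReal_ofReal (by positivity)]
  simp
  ring

/-- A non-integrable function has integral 0 by convention, so the nonzero value 4π already forces
integrability. -/
theorem integrable_bubble : Integrable fun z : E3 => 3 * (‖z‖ ^ 2 + 1) ^ (-5 / 2 : ℝ) := by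
  by_contra h
  have := integral_undef h
  rw [integral_bubble] at this
  have := Real.pi_pos
  linarith

/-- Under y = p + εz the powers ε² · ε⁻⁵ · ε³ cancel, leaving the fixed profile against f(p + εz).
Dominated convergence applies because f is bounded. -/
theorem tendsto_integral_bubble {f : E3 → ℝ} (hf : Continuous f) (hc : HasCompactSupport f)
    (p : E3) :
    Tendsto (fun ε : ℝ => ∫ y, -3 * ε ^ 2 * (‖y - p‖ ^ 2 + ε ^ 2) ^ (-5 / 2 : ℝ) * f y) (𝓝[>] 0)
      (𝓝 (-4 * Real.pi * f p)) := by
  obtain ⟨C, hC⟩ := hf.bounded_above_of_compact_support hc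
  have hscale : ∀ ε : ℝ, 0 < ε →
      ∫ y, -3 * ε ^ 2 * (‖y - p‖ ^ 2 + ε ^ 2) ^ (-5 / 2 : ℝ) * f y =
        -∫ z : E3, 3 * (‖z‖ ^ 2 + 1) ^ (-5 / 2 : ℝ) * f (p + ε • z) := fun ε hε => by
    rw [← integral_add_left_eq_self _ p]
    have := Measure.integral_comp_smul (volume : Measure E3)
      (fun y => -3 * ε ^ 2 * (‖p + y - p‖ ^ 2 + ε ^ 2) ^ (-5 / 2 : ℝ) * f (p + y)) ε
    rw [finrank_E3, abs_of_pos (by positivity), smul_eq_mul, inv_mul_eq_div,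
      eq_div_iff (by positivity)] at this
    rw [← this, ← integral_mul_const, ← integral_neg]
    refine integral_congr_ae (ae_of_all _ fun z => ?_)
    have h1 : ‖p + ε • z - p‖ ^ 2 + ε ^ 2 = ε ^ 2 * (‖z‖ ^ 2 + 1) := by
      rw [add_sub_cancel_left, norm_smul, Real.norm_eq_abs, mul_pow, sq_abs]; ring
    have h2 : (ε ^ 2 : ℝ) ^ (-5 / 2 : ℝ) = (ε ^ 5)⁻¹ := by
      rw [← Real.rpow_natCast ε 2, ← Real.rpow_mul hε.le, ← Real.rpow_natCast ε 5,
        ← Real.rpow_neg hε.le]; norm_num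
    simp only [h1, Real.mul_rpow (sq_nonneg ε) (by positivity : 0 ≤ ‖z‖ ^ 2 + 1), h2]
    field_simp
  have hlim : Tendsto (fun ε : ℝ => ∫ z : E3, 3 * (‖z‖ ^ 2 + 1) ^ (-5 / 2 : ℝ) * f (p + ε • z))
      (𝓝[>] 0) (𝓝 (∫ z : E3, 3 * (‖z‖ ^ 2 + 1) ^ (-5 / 2 : ℝ) * f p)) := by
    refine tendsto_integral_filter_of_dominated_convergence
      (fun z => 3 * (‖z‖ ^ 2 + 1) ^ (-5 / 2 : ℝ) * C) ?_ ?_ (integrable_bubble.mul_const C) ?_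
    · exact Eventually.of_forall fun ε => integrable_bubble.aestronglyMeasurable.mul
        (by fun_prop : Continuous fun z : E3 => f (p + ε • z)).aestronglyMeasurable
    · refine Eventually.of_forall fun ε => ae_of_all _ fun z => ?_
      rw [norm_mul, Real.norm_of_nonneg (by positivity)]
      gcongr
      exact hC _
    · refine ae_of_all _ fun z => Tendsto.const_mul _ ?_
      have : Continuous fun ε : ℝ => f (p + ε • z) := by fun_prop
      simpa using (this.tendsto 0).mono_left nhdsWithin_le_nhds
  rw [integral_mul_const, integral_bubble] at hlim
  have := hlim.neg
  rw [show -(4 * Real.pi * f p) = -4 * Real.pi * f p by ring] at this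
  refine this.congr' ?_
  filter_upwards [self_mem_nhdsWithin] with ε hε using (hscale ε hε).symm

theorem integrable_inv_norm_sub_mul {f : E3 → ℝ} (hf : Continuous f) (hc : HasCompactSupport f)
    (x : E3) : Integrable fun y => ‖x - y‖⁻¹ * f y :=
  (LocallyIntegrable.comp_sub_left locallyIntegrable_inv_norm
    x).integrable_smul_right_of_hasCompactSupport hf hc

/-- The Newton kernel is a fundamental solution of the Laplace equation. -/
theorem sum_newtonConv_pd_pd {f : E3 → ℝ} (hf : ContDiff ℝ 2 f) (hc : HasCompactSupport f)
    (x : E3) : ∑ i, newtonConv (pd i (pd i f)) x = -4 * Real.pi * f x := by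
  have hppf : ∀ i, Continuous (pd i (pd i f)) := fun i =>
    (contDiff_pd (m := 0) (contDiff_pd (m := 1) hf (by norm_num) i) (by norm_num) i).continuous
  have hcc : ∀ i, HasCompactSupport (pd i (pd i f)) := fun i =>
    hasCompactSupport_pd (hasCompactSupport_pd hc i) i
  have hpos : ∀ ε : ℝ, 0 < ε → ∀ y : E3, 0 < ‖y - x‖ ^ 2 + ε ^ 2 := fun ε hε y => by positivity
  have hK : ∀ ε : ℝ, 0 < ε → ∀ n : ℕ∞, ContDiff ℝ n (newtonKernel (ε ^ 2) x) := fun ε hε n =>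
    contDiff_iff_contDiffAt.2 fun y => contDiffAt_newtonKernel (hpos ε hε y)
  -- The regularized kernel is dominated by the Newton kernel and converges to it off the null set y
  -- = x.
  have hlim : ∀ i, Tendsto (fun ε : ℝ => ∫ y, newtonKernel (ε ^ 2) x y * pd i (pd i f) y) (𝓝[>] 0)
      (𝓝 (newtonConv (pd i (pd i f)) x)) := fun i => by
    refine tendsto_integral_filter_of_dominated_convergence
      (fun y => ‖‖x - y‖⁻¹ * pd i (pd i f) y‖) ?_ ?_
      (integrable_inv_norm_sub_mul (hppf i) (hcc i) x).norm ?_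
    · filter_upwards [self_mem_nhdsWithin] with ε hε
      exact ((hK ε hε 0).continuous.mul (hppf i)).aestronglyMeasurable
    · filter_upwards [self_mem_nhdsWithin] with ε hε
      have : ∀ᵐ y : E3, y ≠ x := by simp [ae_iff]
      filter_upwards [this] with y hy
      rw [norm_mul, norm_mul]
      gcongr
      have hxy : 0 < ‖y - x‖ := norm_pos_iff.2 (sub_ne_zero.2 hy)
      rw [norm_sub_rev, ← newtonKernel_zero, newtonKernel, newtonKernel,
        Real.norm_of_nonneg (Real.rpow_nonneg (hpos ε hε y).le _),
        Real.norm_of_nonneg (by positivity)]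
      exact Real.rpow_le_rpow_of_nonpos (by positivity) (by gcongr; positivity) (by norm_num)
    · have : ∀ᵐ y : E3, y ≠ x := by simp [ae_iff]
      filter_upwards [this] with y hy
      refine Tendsto.mul_const _ ?_
      have hxy : 0 < ‖y - x‖ := norm_pos_iff.2 (sub_ne_zero.2 hy)
      rw [norm_sub_rev, ← newtonKernel_zero]
      have h1 : Continuous fun ε : ℝ => ‖y - x‖ ^ 2 + ε ^ 2 := by fun_prop
      have h2 := (h1.tendsto 0).rpow_const (p := -1 / 2) (Or.inl (by positivity))
      simpa [newtonKernel] using h2.mono_left nhdsWithin_le_nhds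
  have h1 := tendsto_finsetSum Finset.univ fun i (_ : i ∈ Finset.univ) => hlim i
  refine tendsto_nhds_unique h1 ((tendsto_integral_bubble hf.continuous hc x).congr' ?_)
  filter_upwards [self_mem_nhdsWithin] with ε hε
  have h2 : ∀ i, Continuous (pd i (pd i (newtonKernel (ε ^ 2) x))) := fun i =>
    (contDiff_pd (m := 0) (contDiff_pd (m := 1) (hK ε hε 2) (by norm_num) i) (by norm_num)
      i).continuous
  -- For ε > 0 the kernel is smooth everywhere, so both derivatives move onto it without a boundary
  -- term at x.
  simp only [fun i => integral_mul_pd_pd (hK ε hε 2) hf hc i]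
  have hint : ∀ i, Integrable fun y => pd i (pd i (newtonKernel (ε ^ 2) x)) y * f y := fun i =>
    ((h2 i).mul hf.continuous).integrable_of_hasCompactSupport hc.mul_left
  rw [← integral_finsetSum _ fun i _ => hint i]
  refine integral_congr_ae (ae_of_all _ fun y => ?_)
  simp only [← Finset.sum_mul, sum_pd_pd_newtonKernel (hpos ε hε y)]

theorem laplacian_newtonConv {f : E3 → ℝ} (hf : ContDiff ℝ 2 f) (hc : HasCompactSupport f)
    (x : E3) : Laplacian.laplacian (newtonConv f) x = -4 * Real.pi * f x := by
  rw [laplacian_eq_sum_pd (contDiff_newtonConv (n := 2) hf hc).contDiffAt,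
    ← sum_newtonConv_pd_pd hf hc]
  refine Finset.sum_congr rfl fun i _ => ?_
  rw [pd_newtonConv (hf.of_le (by norm_num)) hc,
    pd_newtonConv (contDiff_pd hf (by norm_num) i) (hasCompactSupport_pd hc i)]

/-- If f lives in the ball of radius ρ < |x|, the kernel is at most (|x| - ρ)⁻¹ on its support. -/
theorem tendsto_newtonConv {f : E3 → ℝ} (hf : Continuous f) (hc : HasCompactSupport f) :
    Tendsto (newtonConv f) (cocompact E3) (𝓝 0) := by
  obtain ⟨ρ, hρ⟩ : ∃ ρ, ∀ y, ρ < ‖y‖ → f y = 0 := by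
    obtain ⟨ρ, hρ⟩ := hc.isCompact.isBounded.subset_closedBall (0 : E3)
    refine ⟨ρ, fun y hy => by_contra fun h => ?_⟩
    have := hρ (subset_tsupport f h)
    rw [mem_closedBall_zero_iff] at this
    linarith
  have hn : Tendsto (fun x : E3 => ‖x‖ - ρ) (cocompact E3) atTop :=
    tendsto_atTop_add_const_right _ _ tendsto_norm_cocompact_atTop
  have h0 : Tendsto (fun x : E3 => (‖x‖ - ρ)⁻¹ * ∫ y, ‖f y‖) (cocompact E3) (𝓝 0) := by
    simpa using (tendsto_inv_atTop_zero.comp hn).mul_const (∫ y, ‖f y‖)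
  refine squeeze_zero_norm' ?_ h0
  filter_upwards [hn.eventually_gt_atTop 0] with x hx
  rw [← integral_const_mul]
  refine norm_integral_le_of_norm_le
    ((hf.integrable_of_hasCompactSupport hc).norm.const_mul _) (ae_of_all _ fun y => ?_)
  by_cases hy : ρ < ‖y‖
  · simp [hρ y hy]
  · rw [norm_mul, norm_inv, norm_norm]
    gcongr
    have := norm_sub_norm_le x y
    linarith

theorem newtonConv_nonneg {f : E3 → ℝ} (hf : ∀ x, 0 ≤ f x) (x : E3) : 0 ≤ newtonConv f x :=
  integral_nonneg fun y => mul_nonneg (by positivity) (hf y)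

theorem isPotential_newtonConv {A : E3 → ℝ} (hA : ContDiff ℝ 2 A) (hc : HasCompactSupport A) :
    IsPotential A fun x => 1 + newtonConv A x := by
  have h2 := contDiff_newtonConv (n := 2) hA hc
  refine ⟨contDiff_const.add h2, fun x => ?_,
    by simpa using (tendsto_newtonConv hA.continuous hc).const_add 1⟩
  have := (contDiffAt_const (c := (1 : ℝ))).laplacian_add (x := x) h2.contDiffAt
  rw [InnerProductSpace.laplacian_const, laplacian_newtonConv hA hc, Pi.zero_apply] at this
  rw [zero_add] at this
  exact this

/-! ### Upper bound for the Gromov-Hausdorff distance -/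

/-- Distortion at most 2ε is what allows gluing X and Y with each p at distance ε from F p. The
disjoint union is then the common metric space. -/
theorem gromovHausdorffEDist_le {X Y : Type} [MetricSpace X] [MetricSpace Y] [Nonempty X]
    (F : X → Y) {ε : ℝ} (hε : 0 < ε) (H : ∀ p q : X, |dist p q - dist (F p) (F q)| ≤ 2 * ε)
    (hF : ∀ y, ∃ x, dist y (F x) ≤ ε) :
    gromovHausdorffEDist (fun p q : X => edist p q) (fun p q : Y => edist p q) ≤
      ENNReal.ofReal (2 * ε) := by
  let m : MetricSpace (X ⊕ Y) := Metric.glueMetricApprox id F ε hε H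
  have hl : ∀ p q : X, edist (Sum.inl p : X ⊕ Y) (Sum.inl q) = edist p q := fun p q => by
    rw [edist_dist, edist_dist]; rfl
  have hr : ∀ p q : Y, edist (Sum.inr p : X ⊕ Y) (Sum.inr q) = edist p q := fun p q => by
    rw [edist_dist, edist_dist]; rfl
  have hlr : ∀ p : X, dist (Sum.inl p : X ⊕ Y) (Sum.inr (F p)) = ε := fun p =>
    Metric.glueDist_glued_points id F ε p
  refine iInf_le_of_le (X ⊕ Y) (iInf_le_of_le m (iInf_le_of_le Sum.inl (iInf_le_of_le Sum.inr
    (iInf_le_of_le hl (iInf_le_of_le hr ?_)))))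
  refine Metric.hausdorffEDist_le_of_mem_edist ?_ ?_
  · rintro _ ⟨p, rfl⟩
    refine ⟨_, ⟨F p, rfl⟩, ?_⟩
    rw [edist_dist, hlr]
    exact ENNReal.ofReal_le_ofReal (by linarith)
  · rintro _ ⟨y, rfl⟩
    obtain ⟨x, hx⟩ := hF y
    refine ⟨_, ⟨x, rfl⟩, ?_⟩
    rw [edist_dist]
    refine ENNReal.ofReal_le_ofReal ?_
    calc dist (Sum.inr y : X ⊕ Y) (Sum.inl x)
        ≤ dist (Sum.inr y : X ⊕ Y) (Sum.inr (F x)) + dist (Sum.inr (F x) : X ⊕ Y) (Sum.inl x) :=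
          dist_triangle _ _ _
      _ = dist y (F x) + ε := by rw [dist_comm (Sum.inr (F x) : X ⊕ Y), hlr]; rfl
      _ ≤ 2 * ε := by linarith

/-! ### Lengths for conformally flat metrics -/

/-- The length of the restriction of `γ` to `S` for the metric `f · g_E`. -/
def conformalLength (f : E3 → ℝ) (γ : ℝ → E3) (S : Set ℝ) : ENNReal :=
  ∫⁻ t in S, ENNReal.ofReal (Real.sqrt (f (γ t))) * ‖deriv γ t‖ₑ

theorem pathLength_conformal (f : E3 → ℝ) (γ : ℝ → E3) :
    pathLength (conformal f) γ = conformalLength f γ (Set.Icc 0 1) := by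
  refine lintegral_congr fun t => ?_
  have h : ∑ i, ∑ j, conformal f (γ t) i j * deriv γ t i * deriv γ t j =
      f (γ t) * ‖deriv γ t‖ ^ 2 := by
    rw [EuclideanSpace.norm_sq_eq, Finset.mul_sum]
    refine Finset.sum_congr rfl fun i _ => ?_
    simp only [conformal, Matrix.smul_apply, Matrix.one_apply, smul_eq_mul, mul_ite, mul_one,
      mul_zero, ite_mul, zero_mul, Finset.sum_ite_eq, Finset.mem_univ, if_true, Real.norm_eq_abs,
      sq_abs]
    ring
  rw [h, Real.sqrt_mul' _ (sq_nonneg _), Real.sqrt_sq (norm_nonneg _),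
    ENNReal.ofReal_mul (Real.sqrt_nonneg _), ofReal_norm]

/-- Serves reversal (c = -1) and both halves of a concatenation (c = 2). `deriv` commutes with
affine substitutions for every γ, so no regularity is assumed. -/
theorem conformalLength_comp_affine (f : E3 → ℝ) (γ : ℝ → E3) {S : Set ℝ} (hS : MeasurableSet S)
    {c : ℝ} (hc : c ≠ 0) (d : ℝ) :
    conformalLength f (fun t => γ (c * t + d)) S =
      conformalLength f γ ((fun t => c * t + d) '' S) := by
  have hd : ∀ t ∈ S, HasDerivWithinAt (fun t => c * t + d) c S t := fun t _ => by
    simpa using (((hasDerivAt_id t).const_mul c).add_const d).hasDerivWithinAt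
  have hinj : Set.InjOn (fun t => c * t + d) S := fun s _ t _ h => by simpa [hc] using h
  rw [conformalLength, conformalLength, lintegral_image_eq_lintegral_abs_deriv_mul hS hd hinj]
  refine lintegral_congr fun t => ?_
  have : deriv (fun t => γ (c * t + d)) t = c • deriv γ (c * t + d) := by
    have h1 := deriv_comp_mul_left c (fun s => γ (s + d)) t
    rw [h1, deriv_comp_add_const]
  rw [this, enorm_smul, ← ofReal_norm c, Real.norm_eq_abs]
  ring

theorem conformalLength_congr {f : E3 → ℝ} {γ γ' : ℝ → E3} {S : Set ℝ} (hS : IsOpen S)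
    (h : Set.EqOn γ γ' S) : conformalLength f γ S = conformalLength f γ' S := by
  refine setLIntegral_congr_fun hS.measurableSet fun t ht => ?_
  have : γ =ᶠ[𝓝 t] γ' := h.eventuallyEq_of_mem (hS.mem_nhds ht)
  simp only [h ht, this.deriv_eq]

theorem conformalLength_Icc (f : E3 → ℝ) (γ : ℝ → E3) (a b : ℝ) :
    conformalLength f γ (Set.Icc a b) = conformalLength f γ (Set.Ioo a b) :=
  (setLIntegral_congr Ioo_ae_eq_Icc).symm

/-! ### Reversal, concatenation and length of piecewise smooth paths -/

theorem IsPiecewiseSmooth.reverse {γ : ℝ → E3} (h : IsPiecewiseSmooth γ) :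
    IsPiecewiseSmooth fun t => γ (-1 * t + 1) := by
  obtain ⟨hc, P, hP⟩ := h
  refine ⟨hc.comp (by fun_prop) fun t ht => ⟨by linarith [ht.2], by linarith [ht.1]⟩,
    P.image fun p => -1 * p + 1, fun a b ha hab hb hab' => ?_⟩
  refine (hP (-1 * b + 1) (-1 * a + 1) (by linarith) (by linarith) (by linarith)
    fun p hp hp' => ?_).comp (by fun_prop) fun t ht => ⟨by linarith [ht.2], by linarith [ht.1]⟩
  exact hab' (-1 * p + 1) (Finset.mem_image_of_mem _ hp)
    ⟨by linarith [hp'.2], by linarith [hp'.1]⟩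

theorem conformalLength_reverse (f : E3 → ℝ) (γ : ℝ → E3) :
    conformalLength f (fun t => γ (-1 * t + 1)) (Set.Icc 0 1) =
      conformalLength f γ (Set.Icc 0 1) := by
  rw [conformalLength_comp_affine f γ measurableSet_Icc (by norm_num)]
  congr 1
  ext t
  constructor
  · rintro ⟨s, hs, rfl⟩
    exact ⟨by linarith [hs.2], by linarith [hs.1]⟩
  · exact fun ht => ⟨1 - t, ⟨by linarith [ht.2], by linarith [ht.1]⟩, by ring⟩

/-- The concatenation of two paths that are parametrized by `[0,1]`. -/
def concat (γ₁ γ₂ : ℝ → E3) (t : ℝ) : E3 := if t ≤ 1 / 2 then γ₁ (2 * t + 0) else γ₂ (2 * t + -1)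

theorem concat_of_le (γ₁ γ₂ : ℝ → E3) {t : ℝ} (ht : t ≤ 1 / 2) :
    concat γ₁ γ₂ t = γ₁ (2 * t + 0) := if_pos ht

theorem concat_of_ge {γ₁ γ₂ : ℝ → E3} (h : γ₁ 1 = γ₂ 0) {t : ℝ} (ht : 1 / 2 ≤ t) :
    concat γ₁ γ₂ t = γ₂ (2 * t + -1) := by
  rcases ht.eq_or_lt with rfl | ht
  · rw [concat_of_le _ _ le_rfl]; norm_num [h]
  · exact if_neg (not_le.2 ht)

theorem IsPiecewiseSmooth.concat {γ₁ γ₂ : ℝ → E3} (h₁ : IsPiecewiseSmooth γ₁)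
    (h₂ : IsPiecewiseSmooth γ₂) (h : γ₁ 1 = γ₂ 0) : IsPiecewiseSmooth (concat γ₁ γ₂) := by
  obtain ⟨hc₁, P₁, hP₁⟩ := h₁
  obtain ⟨hc₂, P₂, hP₂⟩ := h₂
  refine ⟨?_, {1 / 2} ∪ P₁.image (fun p => p / 2) ∪ P₂.image (fun p => (p + 1) / 2),
    fun a b ha hab hb hP => ?_⟩
  · have hI : Set.Icc (0 : ℝ) 1 = Set.Icc 0 (1 / 2) ∪ Set.Icc (1 / 2) 1 := by
      rw [Set.Icc_union_Icc_eq_Icc] <;> norm_num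
    rw [hI]
    refine ContinuousOn.union_of_isClosed ?_ ?_ isClosed_Icc isClosed_Icc
    · refine (hc₁.comp (f := fun t => 2 * t + 0) (by fun_prop) fun t ht => ?_).congr
        fun t ht => concat_of_le _ _ ht.2
      exact ⟨by linarith [ht.1], by linarith [ht.2]⟩
    · refine (hc₂.comp (f := fun t => 2 * t + -1) (by fun_prop) fun t ht => ?_).congr
        fun t ht => concat_of_ge h ht.1
      exact ⟨by linarith [ht.1], by linarith [ht.2]⟩
  · simp only [Finset.mem_union, Finset.mem_singleton, Finset.mem_image] at hP
    have hhalf := hP (1 / 2) (Or.inl (Or.inl rfl))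
    rcases le_or_gt b (1 / 2) with hb2 | hb2
    · refine ((hP₁ (2 * a + 0) (2 * b + 0) (by linarith) (by linarith) (by linarith)
        fun p hp hp' => ?_).comp (f := fun t => 2 * t + 0) (by fun_prop) fun t ht => ?_).congr
        fun t ht => concat_of_le _ _ (ht.2.trans hb2)
      · exact hP (p / 2) (Or.inl (Or.inr ⟨p, hp, rfl⟩)) ⟨by linarith [hp'.1], by linarith [hp'.2]⟩
      · exact ⟨by linarith [ht.1], by linarith [ht.2]⟩
    · have ha2 : 1 / 2 ≤ a := not_lt.1 fun h' => hhalf ⟨h', hb2⟩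
      refine ((hP₂ (2 * a + -1) (2 * b + -1) (by linarith) (by linarith) (by linarith)
        fun p hp hp' => ?_).comp (f := fun t => 2 * t + -1) (by fun_prop) fun t ht => ?_).congr
        fun t ht => concat_of_ge h (ha2.trans ht.1)
      · exact hP ((p + 1) / 2) (Or.inr ⟨p, hp, rfl⟩) ⟨by linarith [hp'.1], by linarith [hp'.2]⟩
      · exact ⟨by linarith [ht.1], by linarith [ht.2]⟩

theorem conformalLength_concat (f : E3 → ℝ) {γ₁ γ₂ : ℝ → E3} (h : γ₁ 1 = γ₂ 0) :
    conformalLength f (concat γ₁ γ₂) (Set.Icc 0 1) =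
      conformalLength f γ₁ (Set.Icc 0 1) + conformalLength f γ₂ (Set.Icc 0 1) := by
  have hI : Set.Icc (0 : ℝ) 1 = Set.Icc 0 (1 / 2) ∪ Set.Ioc (1 / 2) 1 := by
    rw [Set.Icc_union_Ioc_eq_Icc] <;> norm_num
  have hdisj : Disjoint (Set.Icc (0 : ℝ) (1 / 2)) (Set.Ioc (1 / 2) 1) :=
    Set.disjoint_left.2 fun t h1 h2 => not_lt.2 h1.2 h2.1
  have hoc : conformalLength f (concat γ₁ γ₂) (Set.Ioc (1 / 2) 1) =
      conformalLength f (concat γ₁ γ₂) (Set.Ioo (1 / 2) 1) :=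
    (setLIntegral_congr Ioo_ae_eq_Ioc).symm
  have hsplit : conformalLength f (concat γ₁ γ₂) (Set.Icc 0 1) =
      conformalLength f (concat γ₁ γ₂) (Set.Icc 0 (1 / 2)) +
        conformalLength f (concat γ₁ γ₂) (Set.Ioc (1 / 2) 1) := by
    rw [conformalLength, hI, lintegral_union measurableSet_Ioc hdisj]; rfl
  rw [hsplit, hoc, conformalLength_Icc f _ 0 (1 / 2),
    conformalLength_congr isOpen_Ioo fun t ht => concat_of_le γ₁ γ₂ ht.2.le,
    conformalLength_congr isOpen_Ioo fun t ht => concat_of_ge h ht.1.le,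
    conformalLength_comp_affine f γ₁ measurableSet_Ioo two_ne_zero,
    conformalLength_comp_affine f γ₂ measurableSet_Ioo two_ne_zero, conformalLength_Icc,
    conformalLength_Icc]
  congr 2
  · ext t
    constructor
    · rintro ⟨s, hs, rfl⟩
      exact ⟨by linarith [hs.1], by linarith [hs.2]⟩
    · exact fun ht => ⟨t / 2, ⟨by linarith [ht.1], by linarith [ht.2]⟩, by ring⟩
  · ext t
    constructor
    · rintro ⟨s, hs, rfl⟩
      exact ⟨by linarith [hs.1], by linarith [hs.2]⟩
    · exact fun ht => ⟨(t + 1) / 2, ⟨by linarith [ht.1], by linarith [ht.2]⟩, by ring⟩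

/-- Every other point is interior to a small closed interval free of break points, on which the path
is smooth. -/
theorem IsPiecewiseSmooth.exists_finset_differentiableAt {γ : ℝ → E3} (h : IsPiecewiseSmooth γ) :
    ∃ P : Finset ℝ, ∀ t ∈ Set.Ioo (0 : ℝ) 1, t ∉ P → DifferentiableAt ℝ γ t := by
  obtain ⟨-, P, hP⟩ := h
  refine ⟨P, fun t ht htP => ?_⟩
  have hopen : IsOpen (Set.Ioo (0 : ℝ) 1 ∩ (P : Set ℝ)ᶜ) :=
    isOpen_Ioo.inter P.finite_toSet.isClosed.isOpen_compl
  obtain ⟨ε, hε, hball⟩ := Metric.isOpen_iff.1 hopen t ⟨ht, htP⟩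
  have hsub : Set.Icc (t - ε / 2) (t + ε / 2) ⊆ Set.Ioo (0 : ℝ) 1 ∩ (P : Set ℝ)ᶜ := fun s hs =>
    hball (by rw [Metric.mem_ball, Real.dist_eq, abs_lt]; constructor <;> linarith [hs.1, hs.2])
  have h1 := (hsub (Set.left_mem_Icc.2 (by linarith))).1.1
  have h2 := (hsub (Set.right_mem_Icc.2 (by linarith))).1.2
  have := hP (t - ε / 2) (t + ε / 2) h1.le (by linarith) h2.le
    fun p hp hp' => (hsub (Set.Ioo_subset_Icc_self hp')).2 hp
  exact (this.differentiableOn (by simp)).differentiableAt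
    (Icc_mem_nhds (by linarith) (by linarith))

/-- The fundamental theorem of calculus, with the break points as exceptional set: continuity is
enough there. -/
theorem IsPiecewiseSmooth.edist_le {γ : ℝ → E3} (h : IsPiecewiseSmooth γ) {s t : ℝ} (hs : 0 ≤ s)
    (hst : s ≤ t) (ht : t ≤ 1) : edist (γ s) (γ t) ≤ ∫⁻ r in Set.Icc s t, ‖deriv γ r‖ₑ := by
  obtain ⟨P, hP⟩ := h.exists_finset_differentiableAt
  by_cases hfin : ∫⁻ r in Set.Icc s t, ‖deriv γ r‖ₑ = ⊤
  · simp [hfin]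
  have hint : IntegrableOn (deriv γ) (Set.Icc s t) :=
    ⟨(measurable_deriv γ).aestronglyMeasurable, lt_top_iff_ne_top.2 hfin⟩
  have hFTC := integral_eq_of_hasDerivAt_off_countable_of_le γ (deriv γ) hst
    P.countable_toSet (h.1.mono (Set.Icc_subset_Icc hs ht))
    (fun x hx => (hP x ⟨hs.trans_lt hx.1.1, hx.1.2.trans_le ht⟩ hx.2).hasDerivAt)
    ((intervalIntegrable_iff_integrableOn_Icc_of_le hst).2 hint)
  rw [edist_comm, edist_eq_enorm_sub, ← hFTC, intervalIntegral.integral_of_le hst,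
    ← integral_Icc_eq_integral_Ioc]
  exact enorm_integral_le_lintegral_enorm _

/-! ### The Riemannian distance of a conformally flat metric -/

theorem riemannianDist_le {U : Set E3} {f : E3 → ℝ} {γ : ℝ → E3} (hγ : IsPiecewiseSmooth γ)
    (hU : ∀ t ∈ Set.Icc (0 : ℝ) 1, γ t ∈ U) {x y : U} (h0 : γ 0 = x) (h1 : γ 1 = y) :
    riemannianDist U (conformal f) x y ≤ conformalLength f γ (Set.Icc 0 1) := by
  rw [← pathLength_conformal]
  exact iInf₂_le γ ⟨hγ, hU, h0, h1⟩

theorem exists_path_of_riemannianDist_lt {U : Set E3} {f : E3 → ℝ} {x y : U} {c : ENNReal}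
    (h : riemannianDist U (conformal f) x y < c) :
    ∃ γ : ℝ → E3, IsPiecewiseSmooth γ ∧ (∀ t ∈ Set.Icc (0 : ℝ) 1, γ t ∈ U) ∧ γ 0 = x ∧ γ 1 = y ∧
      conformalLength f γ (Set.Icc 0 1) < c := by
  rw [riemannianDist, iInf_lt_iff] at h
  obtain ⟨γ, h⟩ := h
  rw [iInf_lt_iff] at h
  obtain ⟨⟨h1, h2, h3, h4⟩, h⟩ := h
  exact ⟨γ, h1, h2, h3, h4, by rwa [← pathLength_conformal]⟩

theorem isPiecewiseSmooth_of_contDiff {γ : ℝ → E3} (h : ContDiff ℝ ∞ γ) : IsPiecewiseSmooth γ :=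
  ⟨h.continuous.continuousOn, ∅, fun _ _ _ _ _ _ => h.contDiffOn⟩

theorem riemannianDist_le_of_segment {U : Set E3} {f : E3 → ℝ} {M : ℝ} {x y : U}
    (hU : segment ℝ (x : E3) y ⊆ U) (hf : ∀ z ∈ segment ℝ (x : E3) y, Real.sqrt (f z) ≤ M) :
    riemannianDist U (conformal f) x y ≤ ENNReal.ofReal M * edist (x : E3) y := by
  set γ : ℝ → E3 := fun t => (x : E3) + t • ((y : E3) - x)
  have hmem : ∀ t ∈ Set.Icc (0 : ℝ) 1, γ t ∈ segment ℝ (x : E3) y := fun t ht => by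
    rw [segment_eq_image']; exact ⟨t, ht, rfl⟩
  have hder : ∀ t, deriv γ t = (y : E3) - x := fun t => by
    have : HasDerivAt γ ((1 : ℝ) • ((y : E3) - x)) t :=
      ((hasDerivAt_id t).smul_const ((y : E3) - x)).const_add (x : E3)
    simpa using this.deriv
  refine (riemannianDist_le (f := f) (γ := γ) (isPiecewiseSmooth_of_contDiff (by fun_prop))
    (fun t ht => hU (hmem t ht)) (by simp [γ]) (by simp [γ])).trans ?_
  calc conformalLength f γ (Set.Icc 0 1)
      ≤ ∫⁻ _ in Set.Icc (0 : ℝ) 1, ENNReal.ofReal M * edist (x : E3) y := by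
        refine setLIntegral_mono measurable_const fun t ht => ?_
        rw [hder, edist_comm, edist_eq_enorm_sub]
        gcongr
        exact hf _ (hmem t ht)
    _ = _ := by simp

theorem riemannianDist_self (U : Set E3) (f : E3 → ℝ) (x : U) :
    riemannianDist U (conformal f) x x = 0 := by
  have := riemannianDist_le_of_segment (f := f) (M := Real.sqrt (f x)) (x := x) (y := x)
    (U := U) (by simp) (by simp)
  simpa using this

theorem riemannianDist_comm_le (U : Set E3) (f : E3 → ℝ) (x y : U) :
    riemannianDist U (conformal f) x y ≤ riemannianDist U (conformal f) y x := by
  refine le_of_forall_gt fun c hc => ?_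
  obtain ⟨γ, h1, h2, h3, h4, h5⟩ := exists_path_of_riemannianDist_lt hc
  refine (riemannianDist_le h1.reverse (fun t ht => h2 _ ⟨?_, ?_⟩) ?_ ?_).trans_lt
    ((conformalLength_reverse f γ).trans_lt h5)
  · linarith [ht.2]
  · linarith [ht.1]
  · simpa using h4
  · simpa using h3

theorem riemannianDist_triangle (U : Set E3) (f : E3 → ℝ) (x y z : U) :
    riemannianDist U (conformal f) x z ≤
      riemannianDist U (conformal f) x y + riemannianDist U (conformal f) y z := by
  refine ENNReal.le_of_forall_pos_le_add fun ε hε hfin => ?_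
  have hε2 : ((ε / 2 : NNReal) : ENNReal) ≠ 0 := by simpa using hε.ne'
  obtain ⟨γ₁, h1, h2, h3, h4, h5⟩ := exists_path_of_riemannianDist_lt
    (ENNReal.lt_add_right (ENNReal.add_lt_top.1 hfin).1.ne hε2)
  obtain ⟨γ₂, k1, k2, k3, k4, k5⟩ := exists_path_of_riemannianDist_lt
    (ENNReal.lt_add_right (ENNReal.add_lt_top.1 hfin).2.ne hε2)
  have h : γ₁ 1 = γ₂ 0 := h4.trans k3.symm
  have hmem : ∀ t ∈ Set.Icc (0 : ℝ) 1, concat γ₁ γ₂ t ∈ U := fun t ht => by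
    rcases le_total t (1 / 2) with ht2 | ht2
    · rw [concat_of_le _ _ ht2]
      exact h2 _ ⟨by linarith [ht.1], by linarith⟩
    · rw [concat_of_ge h ht2]
      exact k2 _ ⟨by linarith, by linarith [ht.2]⟩
  refine (riemannianDist_le (h1.concat k1 h) hmem
    (by rw [concat_of_le _ _ (by norm_num)]; simpa using h3)
    (by rw [concat_of_ge h (by norm_num)]; norm_num [k4])).trans ?_
  rw [conformalLength_concat f h]
  calc _ ≤ _ := add_le_add h5.le k5.le
    _ = _ := by
      rw [add_add_add_comm, ← ENNReal.coe_add, add_halves]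

/-- A conformal factor at least 1 makes lengths dominate Euclidean ones; this is why the infimum of
lengths separates points. -/
theorem edist_le_riemannianDist {U : Set E3} {f : E3 → ℝ} (hf : ∀ x ∈ U, 1 ≤ Real.sqrt (f x))
    (x y : U) : edist x y ≤ riemannianDist U (conformal f) x y := by
  refine le_of_forall_gt fun c hc => ?_
  obtain ⟨γ, h1, h2, h3, h4, h5⟩ := exists_path_of_riemannianDist_lt hc
  refine lt_of_le_of_lt ?_ h5
  rw [Subtype.edist_eq, ← h3, ← h4]
  refine (h1.edist_le le_rfl zero_le_one le_rfl).trans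
    (setLIntegral_mono' measurableSet_Icc fun t ht => ?_)
  exact le_mul_of_one_le_left bot_le (by simpa using hf _ (h2 t ht))

/-- The metric space structure of `(U, f · g_E)`, if all distances are finite and `f ≥ 1`. -/
@[reducible] def riemannianMetricSpace (U : Set E3) (f : E3 → ℝ)
    (hf : ∀ x ∈ U, 1 ≤ Real.sqrt (f x))
    (hfin : ∀ x y : U, riemannianDist U (conformal f) x y ≠ ⊤) : MetricSpace U :=
  letI e : EMetricSpace U :=
    { edist := riemannianDist U (conformal f)
      edist_self := riemannianDist_self U f
      edist_comm := fun x y =>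
        le_antisymm (riemannianDist_comm_le U f x y) (riemannianDist_comm_le U f y x)
      edist_triangle := riemannianDist_triangle U f
      eq_of_edist_eq_zero := fun {x y} h => by
        have := edist_le_riemannianDist hf x y
        rw [h] at this
        exact edist_le_zero.1 this }
  EMetricSpace.toMetricSpace hfin

/-! ### The holes -/

/-- The union of the removed balls. -/
def holes (D : ℝ) (n : ℕ) : Set E3 :=
  ⋃ i : BoxIndex n, Metric.ball (center D n i) (D / (n : ℝ) ^ 2)

theorem notMem_holes {D : ℝ} {n : ℕ} {x : E3} :
    x ∉ holes D n ↔ ∀ i, D / (n : ℝ) ^ 2 ≤ ‖x - center D n i‖ := by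
  simp [holes, dist_eq_norm]

theorem norm_le_sum_abs (v : E3) : ‖v‖ ≤ |v 0| + |v 1| + |v 2| := by
  rw [EuclideanSpace.norm_eq, Fin.sum_univ_three]
  refine Real.sqrt_le_iff.2 ⟨by positivity, ?_⟩
  simp only [Real.norm_eq_abs]
  nlinarith [abs_nonneg (v 0), abs_nonneg (v 1), abs_nonneg (v 2),
    mul_nonneg (abs_nonneg (v 0)) (abs_nonneg (v 1)),
    mul_nonneg (abs_nonneg (v 0)) (abs_nonneg (v 2)),
    mul_nonneg (abs_nonneg (v 1)) (abs_nonneg (v 2))]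

theorem abs_coord_le_norm (v : E3) (k : Fin 3) : |v k| ≤ ‖v‖ := by
  simpa using PiLp.norm_apply_le v k

theorem norm_le_of_abs_le {v : E3} {a : ℝ} (h : ∀ k, |v k| ≤ a) : ‖v‖ ≤ Real.sqrt 3 * a := by
  have ha : 0 ≤ a := (abs_nonneg _).trans (h 0)
  rw [EuclideanSpace.norm_eq]
  refine Real.sqrt_le_iff.2 ⟨by positivity, ?_⟩
  rw [mul_pow, Real.sq_sqrt (by norm_num), Fin.sum_univ_three]
  have := fun k => pow_le_pow_left₀ (abs_nonneg _) (h k) 2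
  simp only [Real.norm_eq_abs]
  linarith [this 0, this 1, this 2]

theorem center_apply {D : ℝ} {n : ℕ} (i : BoxIndex n) (k : Fin 3) :
    center D n i k = (((((i k : ℕ) : ℤ) - n : ℤ) : ℝ) + 1 / 2) * (D / n) := by
  simp [center]; ring

theorem norm_center_le {D : ℝ} (hD : 0 < D) {n : ℕ} (hn : 1 ≤ n) (i : BoxIndex n) :
    ‖center D n i‖ ≤ Real.sqrt 3 * D := by
  refine norm_le_of_abs_le fun k => ?_
  have hn' : (0 : ℝ) < n := by exact_mod_cast hn
  have h1 : ((i k : ℕ) : ℝ) + 1 ≤ 2 * n := by exact_mod_cast (i k).2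
  have h0 : (0 : ℝ) ≤ ((i k : ℕ) : ℝ) := by positivity
  rw [center_apply, abs_mul, abs_of_pos (by positivity : 0 < D / n)]
  push_cast
  calc _ ≤ (n : ℝ) * (D / n) := by
        gcongr
        rw [abs_le]; constructor <;> linarith
    _ = D := by field_simp

/-- The source of the assumption n ≥ 2: the hole radius is then at most half the side of a box, so
the open holes miss the grid planes. -/
theorem div_sq_le_half {D : ℝ} (hD : 0 < D) {n : ℕ} (hn : 2 ≤ n) :
    D / (n : ℝ) ^ 2 ≤ 1 / 2 * (D / n) := by
  have hn' : (2 : ℝ) ≤ n := by exact_mod_cast hn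
  rw [div_le_iff₀ (by positivity)]
  have : 1 / 2 * (D / n) * (n : ℝ) ^ 2 = D * n / 2 := by field_simp
  nlinarith

theorem half_le_abs_int_sub (j m : ℤ) : (1 / 2 : ℝ) ≤ |(j : ℝ) - (m + 1 / 2)| := by
  rcases le_or_gt j m with h | h
  · have : (j : ℝ) ≤ m := by exact_mod_cast h
    rw [abs_of_nonpos] <;> linarith
  · have : (m : ℝ) + 1 ≤ j := by exact_mod_cast h
    rw [abs_of_nonneg] <;> linarith

/-- The planes of the grid are disjoint from the holes. -/
theorem notMem_holes_of_coord {D : ℝ} (hD : 0 < D) {n : ℕ} (hn : 2 ≤ n) {z : E3} {k : Fin 3} {j : ℤ}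
    (hz : z k = j * (D / n)) : z ∉ holes D n := by
  rw [notMem_holes]
  intro i
  have hn' : (2 : ℝ) ≤ n := by exact_mod_cast hn
  have hh : 0 < D / n := by positivity
  refine (div_sq_le_half hD hn).trans (le_trans ?_ (abs_coord_le_norm _ k))
  rw [PiLp.sub_apply, center_apply, hz, ← sub_mul, abs_mul, abs_of_pos hh]
  gcongr
  exact half_le_abs_int_sub _ _

/-- In units of the box side, hole centers have half-integer coordinates m + 1/2. As `round u` is a
nearest integer, it lies on the same side of m + 1/2 as u. The motion from u to it either recedes
from m + 1/2 or approaches it no further than an integer. -/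
theorem abs_sub_half_of_mem_uIcc_round {u w : ℝ} (hw : w ∈ Set.uIcc u (round u)) (m : ℤ) :
    1 / 2 ≤ |w - (m + 1 / 2)| ∨ |u - (m + 1 / 2)| ≤ |w - (m + 1 / 2)| := by
  have hr := abs_le.1 (abs_sub_round u)
  rcases le_or_gt (round u) m with h | h
  · have h' : (round u : ℝ) ≤ m := by exact_mod_cast h
    rcases Set.mem_uIcc.1 hw with hw | hw
    · left; rw [abs_of_nonpos] <;> linarith
    · right; rw [abs_of_nonpos, abs_of_nonpos] <;> linarith
  · have h' : (m : ℝ) + 1 ≤ round u := by exact_mod_cast h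
    rcases Set.mem_uIcc.1 hw with hw | hw
    · right; rw [abs_of_nonneg, abs_of_nonneg] <;> linarith
    · left; rw [abs_of_nonneg] <;> linarith

/-- Moving the first coordinate to the nearest grid plane does not lead into a hole. -/
theorem notMem_holes_of_mem_uIcc_round {D : ℝ} (hD : 0 < D) {n : ℕ} (hn : 2 ≤ n) {x z : E3}
    (hx : x ∉ holes D n) (h0 : z 0 / (D / n) ∈ Set.uIcc (x 0 / (D / n)) (round (x 0 / (D / n))))
    (h1 : z 1 = x 1) (h2 : z 2 = x 2) : z ∉ holes D n := by
  rw [notMem_holes] at hx ⊢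
  intro i
  have hn' : (2 : ℝ) ≤ n := by exact_mod_cast hn
  have hh : 0 < D / n := by positivity
  have hsc : ∀ (a : ℝ) (m : ℤ),
      |a - (m + 1 / 2) * (D / n)| = |a / (D / n) - (m + 1 / 2)| * (D / n) :=
    fun a m => by
      rw [← abs_of_pos hh, ← abs_mul, abs_of_pos hh, sub_mul, div_mul_cancel₀ _ hh.ne']
  rcases abs_sub_half_of_mem_uIcc_round h0 (((i 0 : ℕ) : ℤ) - n) with h | h
  · refine (div_sq_le_half hD hn).trans (le_trans ?_ (abs_coord_le_norm _ 0))
    rw [PiLp.sub_apply, center_apply, hsc]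
    gcongr
  · refine (hx i).trans ?_
    rw [EuclideanSpace.norm_eq, EuclideanSpace.norm_eq]
    refine Real.sqrt_le_sqrt ?_
    rw [Fin.sum_univ_three, Fin.sum_univ_three]
    simp only [PiLp.sub_apply, h1, h2, Real.norm_eq_abs]
    gcongr ?_ ^ 2 + _ + _
    rw [center_apply, hsc, hsc]
    gcongr

theorem coord_mem_uIcc_of_mem_segment {a b z : E3} (hz : z ∈ segment ℝ a b) (k : Fin 3) :
    z k ∈ Set.uIcc (a k) (b k) := by
  rw [← segment_eq_uIcc]
  obtain ⟨s, t, hs, ht, hst, rfl⟩ := hz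
  exact ⟨s, t, hs, ht, hst, by simp⟩

theorem div_mem_uIcc {a b c h : ℝ} (hh : 0 < h) (hc : c ∈ Set.uIcc a b) :
    c / h ∈ Set.uIcc (a / h) (b / h) := by
  rcases Set.mem_uIcc.1 hc with hc | hc
  · exact Set.mem_uIcc.2 (Or.inl ⟨by gcongr; exact hc.1, by gcongr; exact hc.2⟩)
  · exact Set.mem_uIcc.2 (Or.inr ⟨by gcongr; exact hc.1, by gcongr; exact hc.2⟩)

theorem riemannianDist_perforatedBall_le_of_segment {D R M : ℝ} {n : ℕ} {f : E3 → ℝ}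
    (hM : ∀ z ∈ perforatedBall D R n, Real.sqrt (f z) ≤ M) (x y : perforatedBall D R n)
    (h : ∀ z ∈ segment ℝ (x : E3) y, z ∉ holes D n) {a : ℝ} (ha : ‖(x : E3) - y‖ ≤ a) :
    riemannianDist (perforatedBall D R n) (conformal f) x y ≤ ENNReal.ofReal (M * a) := by
  have hsub : segment ℝ (x : E3) y ⊆ perforatedBall D R n := fun z hz =>
    ⟨(convex_ball 0 R).segment_subset x.2.1 y.2.1 hz, h z hz⟩
  refine (riemannianDist_le_of_segment hsub fun z hz => hM z (hsub hz)).trans ?_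
  have hM0 : 0 ≤ M := (Real.sqrt_nonneg _).trans (hM x x.2)
  rw [edist_dist, dist_eq_norm, ← ENNReal.ofReal_mul hM0]
  gcongr

/-- Points of the perforated ball that are close to each other in the Euclidean distance are close
to each other in the perforated ball. -/
theorem riemannianDist_perforatedBall_le {D R M : ℝ} (hD : 0 < D) {n : ℕ} (hn : 2 ≤ n)
    {f : E3 → ℝ} (hM : ∀ z ∈ perforatedBall D R n, Real.sqrt (f z) ≤ M)
    (x y : perforatedBall D R n) {l : ℝ} (hl : ‖(x : E3) - y‖ + D / n ≤ l)
    (hlR : Real.sqrt 3 * D + 5 * l < R) :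
    riemannianDist (perforatedBall D R n) (conformal f) x y ≤ ENNReal.ofReal (M * (6 * l)) := by
  have hn' : (2 : ℝ) ≤ n := by exact_mod_cast hn
  have hh : 0 < D / n := by positivity
  have hM0 : 0 ≤ M := (Real.sqrt_nonneg _).trans (hM x x.2)
  have hxyl : ‖(x : E3) - y‖ ≤ l := by linarith
  have hl0 : 0 < l := by linarith [norm_nonneg ((x : E3) - y)]
  -- A segment without holes is used directly. One that meets a hole starts close to the box, which
  -- leaves room in B(0,R) for a detour.
  by_cases hseg : ∀ z ∈ segment ℝ (x : E3) y, z ∉ holes D n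
  · exact riemannianDist_perforatedBall_le_of_segment hM x y hseg (by linarith)
  push Not at hseg
  obtain ⟨z, hz, hzh⟩ := hseg
  obtain ⟨i, hi⟩ := Set.mem_iUnion.1 hzh
  have hxz : ‖(x : E3) - z‖ ≤ ‖(x : E3) - y‖ := by
    rw [segment_eq_image'] at hz
    obtain ⟨t, ht, rfl⟩ := hz
    have : (x : E3) - (x + t • ((y : E3) - x)) = t • ((x : E3) - y) := by module
    rw [this, norm_smul, Real.norm_of_nonneg ht.1]
    exact mul_le_of_le_one_left (norm_nonneg _) ht.2
  have hxn : ‖(x : E3)‖ ≤ Real.sqrt 3 * D + l := by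
    have h1 : ‖z - center D n i‖ ≤ D / n := by
      rw [Metric.mem_ball, dist_eq_norm] at hi
      linarith [div_sq_le_half hD hn]
    have h2 := norm_center_le hD (by omega) i
    calc ‖(x : E3)‖ = ‖((x : E3) - z) + (z - center D n i) + center D n i‖ := by congr 1; abel
      _ ≤ _ := norm_add₃_le
      _ ≤ _ := by linarith
  have hyn : ‖(y : E3)‖ ≤ Real.sqrt 3 * D + 2 * l := by
    have := norm_sub_norm_le (y : E3) x
    rw [norm_sub_rev] at this
    linarith
  set h : ℝ := D / n
  have hround : ∀ a : ℝ, |a - round (a / h) * h| ≤ h / 2 := fun a => by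
    have h1 := abs_sub_round (a / h)
    have h2 : a - round (a / h) * h = (a / h - round (a / h)) * h := by
      field_simp
    rw [h2, abs_mul, abs_of_pos hh]
    nlinarith
  have hd := fun k => abs_coord_le_norm ((x : E3) - y) k
  simp only [PiLp.sub_apply] at hd
  have hx0 := abs_le.1 (hround ((x : E3) 0))
  have hy0 := abs_le.1 (hround ((y : E3) 0))
  have hy1 := abs_le.1 (hround ((y : E3) 1))
  have hd0 := abs_le.1 (hd 0)
  have hd1 := abs_le.1 (hd 1)
  have hd2 := abs_le.1 (hd 2)
  set a : ℤ := round ((x : E3) 0 / h) with ha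
  set a' : ℤ := round ((y : E3) 0 / h) with ha'
  set b : ℤ := round ((y : E3) 1 / h) with hb
  -- The first and last legs move only the first coordinate, to the grid plane nearest to x or from
  -- the one nearest to y. In between the path stays in the planes of a, b and a', in this order;
  -- the b-plane permits the change from a to a'. The legs have lengths at most l, 2l, l, l, l,
  -- whence the factor 6.
  let p₁ : E3 := !₂[(a : ℝ) * h, (x : E3) 1, (x : E3) 2]
  let p₂ : E3 := !₂[(a : ℝ) * h, (b : ℝ) * h, (y : E3) 2]
  let p₃ : E3 := !₂[(a' : ℝ) * h, (b : ℝ) * h, (y : E3) 2]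
  let p₄ : E3 := !₂[(a' : ℝ) * h, (y : E3) 1, (y : E3) 2]
  have e1 : ‖(x : E3) - p₁‖ ≤ l := by
    refine (norm_le_sum_abs _).trans ?_
    simp only [p₁, PiLp.sub_apply]
    simp
    rw [abs_le]; constructor <;> linarith
  have e2 : ‖p₁ - p₂‖ ≤ 2 * l := by
    refine (norm_le_sum_abs _).trans ?_
    simp only [p₁, p₂, PiLp.sub_apply]
    simp
    have k1 : |(x : E3) 1 - b * h| ≤ ‖(x : E3) - y‖ + h / 2 := by
      rw [abs_le]; constructor <;> linarith
    linarith [hd 2]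
  have e3 : ‖p₂ - p₃‖ ≤ l := by
    refine (norm_le_sum_abs _).trans ?_
    simp only [p₂, p₃, PiLp.sub_apply]
    simp
    rw [abs_le]; constructor <;> linarith
  have e4 : ‖p₃ - p₄‖ ≤ l := by
    refine (norm_le_sum_abs _).trans ?_
    simp only [p₃, p₄, PiLp.sub_apply]
    simp
    rw [abs_le]; constructor <;> linarith
  have e5 : ‖p₄ - (y : E3)‖ ≤ l := by
    refine (norm_le_sum_abs _).trans ?_
    simp only [p₄, PiLp.sub_apply]
    simp
    rw [abs_le]; constructor <;> linarith
  have s1 : ∀ z ∈ segment ℝ (x : E3) p₁, z ∉ holes D n := fun z hz => by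
    have c := coord_mem_uIcc_of_mem_segment hz
    refine notMem_holes_of_mem_uIcc_round hD hn x.2.2 ?_ (by simpa [p₁] using c 1)
      (by simpa [p₁] using c 2)
    have := div_mem_uIcc hh (c 0)
    simpa [p₁, hh.ne'] using this
  have s2 : ∀ z ∈ segment ℝ p₁ p₂, z ∉ holes D n := fun z hz =>
    notMem_holes_of_coord hD hn (k := 0) (j := a)
      (by simpa [p₁, p₂] using coord_mem_uIcc_of_mem_segment hz 0)
  have s3 : ∀ z ∈ segment ℝ p₂ p₃, z ∉ holes D n := fun z hz =>
    notMem_holes_of_coord hD hn (k := 1) (j := b)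
      (by simpa [p₂, p₃] using coord_mem_uIcc_of_mem_segment hz 1)
  have s4 : ∀ z ∈ segment ℝ p₃ p₄, z ∉ holes D n := fun z hz =>
    notMem_holes_of_coord hD hn (k := 0) (j := a')
      (by simpa [p₃, p₄] using coord_mem_uIcc_of_mem_segment hz 0)
  have s5 : ∀ z ∈ segment ℝ p₄ (y : E3), z ∉ holes D n := fun z hz => by
    rw [segment_symm] at hz
    have c := coord_mem_uIcc_of_mem_segment hz
    refine notMem_holes_of_mem_uIcc_round hD hn y.2.2 ?_ (by simpa [p₄] using c 1)
      (by simpa [p₄] using c 2)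
    have := div_mem_uIcc hh (c 0)
    simpa [p₄, hh.ne'] using this
  have hball : ∀ {q : E3}, ‖q‖ < R → q ∉ holes D n → q ∈ perforatedBall D R n := fun h1 h2 =>
    ⟨mem_ball_zero_iff.2 h1, h2⟩
  have n1 : ‖p₁‖ ≤ Real.sqrt 3 * D + 2 * l := by
    have := norm_sub_norm_le p₁ x; rw [norm_sub_rev] at this; linarith
  have n2 : ‖p₂‖ ≤ Real.sqrt 3 * D + 4 * l := by
    have := norm_sub_norm_le p₂ p₁; rw [norm_sub_rev] at this; linarith
  have n4 : ‖p₄‖ ≤ Real.sqrt 3 * D + 3 * l := by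
    have := norm_sub_norm_le p₄ y; linarith
  have n3 : ‖p₃‖ ≤ Real.sqrt 3 * D + 4 * l := by
    have := norm_sub_norm_le p₃ p₄; linarith
  let q₁ : perforatedBall D R n := ⟨p₁, hball (by linarith) (s1 _ (right_mem_segment _ _ _))⟩
  let q₂ : perforatedBall D R n := ⟨p₂, hball (by linarith) (s2 _ (right_mem_segment _ _ _))⟩
  let q₃ : perforatedBall D R n := ⟨p₃, hball (by linarith) (s3 _ (right_mem_segment _ _ _))⟩
  let q₄ : perforatedBall D R n := ⟨p₄, hball (by linarith) (s4 _ (right_mem_segment _ _ _))⟩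
  have t1 := riemannianDist_perforatedBall_le_of_segment hM x q₁ s1 e1
  have t2 := riemannianDist_perforatedBall_le_of_segment hM q₁ q₂ s2 e2
  have t3 := riemannianDist_perforatedBall_le_of_segment hM q₂ q₃ s3 e3
  have t4 := riemannianDist_perforatedBall_le_of_segment hM q₃ q₄ s4 e4
  have t5 := riemannianDist_perforatedBall_le_of_segment hM q₄ y s5 e5
  have tri := riemannianDist_triangle (perforatedBall D R n) f
  calc _ ≤ _ := tri x q₁ y
    _ ≤ _ := add_le_add t1 ((tri q₁ q₂ y).trans (add_le_add t2 ((tri q₂ q₃ y).trans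
        (add_le_add t3 ((tri q₃ q₄ y).trans (add_le_add t4 t5))))))
    _ = _ := by
      rw [← ENNReal.ofReal_add (by positivity) (by positivity),
        ← ENNReal.ofReal_add (by positivity) (by positivity),
        ← ENNReal.ofReal_add (by positivity) (by positivity),
        ← ENNReal.ofReal_add (by positivity) (by positivity)]
      congr 1; ring

/-! ### Moving paths off the holes by small translations -/

/-- A set that is covered by few balls has a small translate that misses the holes. -/
theorem exists_translate_notMem_holes {D : ℝ} (hD : 0 < D) {n : ℕ} (hn : 1 ≤ n) {S : Set E3}
    (T : Finset E3) (hT : ∀ s ∈ S, ∃ c ∈ T, ‖s - c‖ ≤ D / (n : ℝ) ^ 2) {δ : ℝ}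
    (hδ : 0 < δ) (hcard : (2 * n : ℝ) ^ 3 * (T.card * (2 * (D / (n : ℝ) ^ 2)) ^ 3) < δ ^ 3) :
    ∃ v : E3, ‖v‖ < δ ∧ ∀ s ∈ S, s + v ∉ holes D n := by
  have hn' : (0 : ℝ) < n := by exact_mod_cast hn
  set r : ℝ := D / (n : ℝ) ^ 2
  have hr : 0 < r := by positivity
  by_contra! hcon
  -- If s + v lies in the hole at p and s is within r of c, then v is within 2r of p - c. If every v
  -- failed, these balls would cover the ball of radius δ, contradicting `hcard` by volume.
  have hsub : Metric.ball (0 : E3) δ ⊆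
      ⋃ i : BoxIndex n, ⋃ c ∈ T, Metric.ball (center D n i - c) (2 * r) := fun v hv => by
    obtain ⟨s, hs, hsv⟩ := hcon v (mem_ball_zero_iff.1 hv)
    obtain ⟨i, hi⟩ := Set.mem_iUnion.1 hsv
    obtain ⟨c, hc, hsc⟩ := hT s hs
    refine Set.mem_iUnion.2 ⟨i, Set.mem_iUnion₂.2 ⟨c, hc, ?_⟩⟩
    rw [Metric.mem_ball, dist_eq_norm] at hi ⊢
    calc ‖v - (center D n i - c)‖ = ‖(s + v - center D n i) - (s - c)‖ := by congr 1; abel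
      _ ≤ _ := norm_sub_le _ _
      _ < _ := by linarith
  have hvol : ∀ (x : E3) {t : ℝ}, 0 ≤ t → volume (Metric.ball x t) =
      ENNReal.ofReal (t ^ 3) * volume (Metric.ball (0 : E3) 1) := fun x t ht => by
    rw [Measure.addHaar_ball _ _ ht, finrank_euclideanSpace_fin]
  have h1 : volume (Metric.ball (0 : E3) δ) ≤
      ∑ _i : BoxIndex n, ∑ _c ∈ T,
        ENNReal.ofReal ((2 * r) ^ 3) * volume (Metric.ball (0 : E3) 1) := by
    refine (measure_mono hsub).trans ((measure_iUnion_fintype_le _ _).trans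
      (Finset.sum_le_sum fun i _ => (measure_biUnion_finset_le _ _).trans
        (Finset.sum_le_sum fun c _ => ?_)))
    rw [hvol _ (by positivity)]
  have hb0 : volume (Metric.ball (0 : E3) 1) ≠ 0 := (Metric.measure_ball_pos _ _ one_pos).ne'
  have hbt : volume (Metric.ball (0 : E3) 1) ≠ ⊤ := measure_ball_lt_top.ne
  rw [hvol _ hδ.le, Finset.sum_const, Finset.sum_const, nsmul_eq_mul, nsmul_eq_mul, ← mul_assoc,
    ← mul_assoc, ENNReal.mul_le_mul_iff_left hb0 hbt, ← ENNReal.ofReal_natCast,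
    ← ENNReal.ofReal_natCast, ← ENNReal.ofReal_mul (by positivity),
    ← ENNReal.ofReal_mul (by positivity), ENNReal.ofReal_le_ofReal_iff (by positivity)] at h1
  simp only [Finset.card_univ, Fintype.card_pi, Fintype.card_fin, Finset.prod_const] at h1
  push_cast at h1
  linarith

/-- Arc length Λ is cut into steps of length r, and one point of the path is sampled in each. Points
in the same step are at distance at most r. -/
theorem IsPiecewiseSmooth.exists_cover {γ : ℝ → E3} (h : IsPiecewiseSmooth γ) {L r : ℝ}
    (hL : 0 ≤ L) (hr : 0 < r) (hγ : ∫⁻ t in Set.Icc (0 : ℝ) 1, ‖deriv γ t‖ₑ ≤ ENNReal.ofReal L) :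
    ∃ T : Finset E3, (T.card : ℝ) ≤ L / r + 1 ∧
      ∀ t ∈ Set.Icc (0 : ℝ) 1, ∃ c ∈ T, ‖γ t - c‖ ≤ r := by
  classical
  set Λ : ℝ → ENNReal := fun t => ∫⁻ s in Set.Icc 0 t, ‖deriv γ s‖ₑ with hΛ
  have hΛL : ∀ t ∈ Set.Icc (0 : ℝ) 1, Λ t ≤ ENNReal.ofReal L := fun t ht =>
    (lintegral_mono_set (Set.Icc_subset_Icc le_rfl ht.2)).trans hγ
  have hΛtop : ∀ t ∈ Set.Icc (0 : ℝ) 1, Λ t ≠ ⊤ := fun t ht =>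
    ((hΛL t ht).trans_lt ENNReal.ofReal_lt_top).ne
  have hle : ∀ s ∈ Set.Icc (0 : ℝ) 1, ∀ t ∈ Set.Icc (0 : ℝ) 1, s ≤ t →
      ‖γ s - γ t‖ ≤ (Λ t).toReal - (Λ s).toReal := fun s hs t ht hst => by
    have hadd : Λ t = Λ s + ∫⁻ r in Set.Icc s t, ‖deriv γ r‖ₑ := by
      have : ∫⁻ r in Set.Icc s t, ‖deriv γ r‖ₑ = ∫⁻ r in Set.Ioc s t, ‖deriv γ r‖ₑ :=
        (setLIntegral_congr Ioc_ae_eq_Icc).symm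
      rw [this, hΛ]
      simp only
      rw [← Set.Icc_union_Ioc_eq_Icc hs.1 hst, lintegral_union measurableSet_Ioc
        (Set.disjoint_left.2 fun t h1 h2 => not_lt.2 h1.2 h2.1)]
    have h1 := h.edist_le hs.1 hst ht.2
    have h2 : Λ s + edist (γ s) (γ t) ≤ Λ t := hadd ▸ add_le_add le_rfl h1
    have h3 := ENNReal.toReal_mono (hΛtop t ht) h2
    rw [ENNReal.toReal_add (hΛtop s hs) (edist_ne_top _ _), edist_dist,
      ENNReal.toReal_ofReal dist_nonneg, dist_eq_norm] at h3
    linarith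
  have hle' : ∀ s ∈ Set.Icc (0 : ℝ) 1, ∀ t ∈ Set.Icc (0 : ℝ) 1,
      ‖γ s - γ t‖ ≤ |(Λ t).toReal - (Λ s).toReal| := fun s hs t ht => by
    rcases le_total s t with hst | hst
    · exact (hle s hs t ht hst).trans (le_abs_self _)
    · rw [norm_sub_rev, abs_sub_comm]
      exact (hle t ht s hs hst).trans (le_abs_self _)
  let idx : ℝ → ℕ := fun t => ⌊(Λ t).toReal / r⌋₊
  -- The sample time of an index that is never attained is irrelevant; 0 is used.
  have hchoice : ∀ k : ℕ, ∃ τ : ℝ, (∃ t ∈ Set.Icc (0 : ℝ) 1, idx t = k) →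
      τ ∈ Set.Icc (0 : ℝ) 1 ∧ idx τ = k := fun k => by
    by_cases hk : ∃ t ∈ Set.Icc (0 : ℝ) 1, idx t = k
    · obtain ⟨t, ht⟩ := hk
      exact ⟨t, fun _ => ht⟩
    · exact ⟨0, fun h => absurd h hk⟩
  choose τ hτ using hchoice
  refine ⟨(Finset.range (⌊L / r⌋₊ + 1)).image fun k => γ (τ k), ?_, fun t ht => ?_⟩
  · have h1 : (((Finset.range (⌊L / r⌋₊ + 1)).image fun k => γ (τ k)).card : ℝ) ≤
        (⌊L / r⌋₊ + 1 : ℕ) := by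
      exact_mod_cast Finset.card_image_le.trans (Finset.card_range _).le
    have h2 := Nat.floor_le (div_nonneg hL hr.le)
    push_cast at h1
    linarith
  · obtain ⟨hτI, hτk⟩ := hτ (idx t) ⟨t, ht, rfl⟩
    refine ⟨γ (τ (idx t)), Finset.mem_image_of_mem _ (Finset.mem_range.2 ?_), ?_⟩
    · refine Nat.lt_succ_of_le (Nat.floor_le_floor ?_)
      gcongr
      exact ENNReal.toReal_le_of_le_ofReal hL (hΛL t ht)
    · refine (hle' t ht _ hτI).trans ?_
      have f1 := Nat.floor_le (div_nonneg (ENNReal.toReal_nonneg (a := Λ t)) hr.le)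
      have f2 := Nat.lt_floor_add_one ((Λ t).toReal / r)
      have f3 := Nat.floor_le (div_nonneg (ENNReal.toReal_nonneg (a := Λ (τ (idx t)))) hr.le)
      have f4 := Nat.lt_floor_add_one ((Λ (τ (idx t))).toReal / r)
      have f5 : ⌊(Λ (τ (idx t))).toReal / r⌋₊ = ⌊(Λ t).toReal / r⌋₊ := hτk
      rw [f5] at f3 f4
      rw [le_div_iff₀ hr] at f1 f3
      rw [div_lt_iff₀ hr] at f2 f4
      rw [abs_le]; constructor <;> nlinarith

/-! ### The Riemann sums converge to the Newton potential -/

/-- The half-open subdivision boxes. -/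
def subBox (D : ℝ) (n : ℕ) (i : BoxIndex n) : Set E3 :=
  {y | ∀ k, y k ∈ Set.Ico ((((i k : ℕ) : ℝ) - n) * (D / n)) ((((i k : ℕ) : ℝ) - n + 1) * (D / n))}

theorem subBox_eq_preimage (D : ℝ) (n : ℕ) (i : BoxIndex n) :
    subBox D n i = WithLp.ofLp ⁻¹' Set.univ.pi fun k =>
      Set.Ico ((((i k : ℕ) : ℝ) - n) * (D / n)) ((((i k : ℕ) : ℝ) - n + 1) * (D / n)) := by
  ext y; simp [subBox]

theorem measurableSet_subBox (D : ℝ) (n : ℕ) (i : BoxIndex n) : MeasurableSet (subBox D n i) := by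
  rw [subBox_eq_preimage]
  exact (PiLp.volume_preserving_ofLp (Fin 3)).measurable
    (MeasurableSet.univ_pi fun _ => measurableSet_Ico)

theorem volume_subBox {D : ℝ} (hD : 0 ≤ D) (n : ℕ) (i : BoxIndex n) :
    volume (subBox D n i) = ENNReal.ofReal ((D / n) ^ 3) := by
  rw [subBox_eq_preimage, (PiLp.volume_preserving_ofLp (Fin 3)).measure_preimage
    (MeasurableSet.univ_pi fun _ => measurableSet_Ico).nullMeasurableSet, Real.volume_pi_Ico]
  have : ∀ k, (((i k : ℕ) : ℝ) - n + 1) * (D / n) - (((i k : ℕ) : ℝ) - n) * (D / n) = D / n :=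
    fun k => by ring
  simp only [this, Finset.prod_const, Finset.card_univ, Fintype.card_fin]
  rw [ENNReal.ofReal_pow (by positivity)]

theorem abs_sub_center_le {D : ℝ} {n : ℕ} {i : BoxIndex n} {y : E3}
    (hy : y ∈ subBox D n i) (k : Fin 3) : |(y - center D n i) k| ≤ 1 / 2 * (D / n) := by
  have := hy k
  rw [PiLp.sub_apply, center_apply, abs_le]
  push_cast
  constructor <;> linarith [this.1, this.2]

theorem norm_sub_center_le {D : ℝ} (hD : 0 ≤ D) {n : ℕ} {i : BoxIndex n} {y : E3}
    (hy : y ∈ subBox D n i) : ‖y - center D n i‖ ≤ D / n := by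
  refine (norm_le_of_abs_le (abs_sub_center_le hy)).trans ?_
  have h3 : Real.sqrt 3 ≤ 2 := Real.sqrt_le_iff.2 (by norm_num)
  have : 0 ≤ D / n := by positivity
  nlinarith

theorem exists_mem_subBox {D : ℝ} (hD : 0 < D) {n : ℕ} (hn : 1 ≤ n) {y : E3}
    (hy : ∀ k, y k ∈ Set.Ico (-D) D) : ∃ i, y ∈ subBox D n i := by
  have hn' : (0 : ℝ) < n := by exact_mod_cast hn
  have hh : 0 < D / n := by positivity
  have hnh : (n : ℝ) * (D / n) = D := by field_simp
  have h0 : ∀ k, 0 ≤ ⌊y k / (D / n)⌋ + n := fun k => by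
    have : -(n : ℤ) ≤ ⌊y k / (D / n)⌋ := by
      rw [Int.le_floor, le_div_iff₀ hh]; push_cast; linarith [(hy k).1]
    omega
  have h1 : ∀ k, ⌊y k / (D / n)⌋ + n < 2 * n := fun k => by
    have : ⌊y k / (D / n)⌋ < n := by
      rw [Int.floor_lt, div_lt_iff₀ hh]; push_cast; linarith [(hy k).2]
    omega
  refine ⟨fun k => ⟨(⌊y k / (D / n)⌋ + n).toNat, by have := h0 k; have := h1 k; omega⟩, fun k => ?_⟩
  have hc : (((⌊y k / (D / n)⌋ + n).toNat : ℕ) : ℝ) = ⌊y k / (D / n)⌋ + n := by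
    have := Int.toNat_of_nonneg (h0 k)
    exact_mod_cast this
  simp only [hc, add_sub_cancel_right]
  have f1 := Int.floor_le (y k / (D / n))
  have f2 := Int.lt_floor_add_one (y k / (D / n))
  exact ⟨(le_div_iff₀ hh).1 f1, (div_lt_iff₀ hh).1 f2⟩

theorem eq_of_mem_subBox {D : ℝ} (hD : 0 < D) {n : ℕ} (hn : 1 ≤ n) {y : E3} {i j : BoxIndex n}
    (hi : y ∈ subBox D n i) (hj : y ∈ subBox D n j) : i = j := by
  have hn' : (0 : ℝ) < n := by exact_mod_cast hn
  have hh : 0 < D / n := by positivity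
  ext k
  have h1 := lt_of_mul_lt_mul_right ((hi k).1.trans_lt (hj k).2) hh.le
  have h2 := lt_of_mul_lt_mul_right ((hj k).1.trans_lt (hi k).2) hh.le
  have h3 : ((i k : ℕ) : ℝ) < (j k : ℕ) + 1 := by linarith
  have h4 : ((j k : ℕ) : ℝ) < (i k : ℕ) + 1 := by linarith
  have h5 : (i k : ℕ) < (j k : ℕ) + 1 := by exact_mod_cast h3
  have h6 : (j k : ℕ) < (i k : ℕ) + 1 := by exact_mod_cast h4
  omega

theorem subBox_subset_box {D : ℝ} (hD : 0 < D) {n : ℕ} (hn : 1 ≤ n) (i : BoxIndex n) :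
    subBox D n i ⊆ box D := fun y hy k => by
  have hn' : (0 : ℝ) < n := by exact_mod_cast hn
  have hh : 0 < D / n := by positivity
  have hnh : (n : ℝ) * (D / n) = D := by field_simp
  have h1 : ((i k : ℕ) : ℝ) + 1 ≤ 2 * n := by exact_mod_cast (i k).2
  have h0 : (0 : ℝ) ≤ ((i k : ℕ) : ℝ) := by positivity
  constructor
  · refine le_trans ?_ (hy k).1
    nlinarith
  · refine (hy k).2.le.trans ?_
    nlinarith

theorem box_subset_closedBall {D : ℝ} : box D ⊆ Metric.closedBall 0 (Real.sqrt 3 * D) :=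
  fun _ hy => mem_closedBall_zero_iff.2 (norm_le_of_abs_le fun k => abs_le.2 (hy k))

theorem isClosed_box (D : ℝ) : IsClosed (box D) := by
  simp only [box, Set.ofPred_forall]
  exact isClosed_iInter fun k => isClosed_Icc.preimage (by fun_prop)

theorem isCompact_box (D : ℝ) : IsCompact (box D) :=
  (isCompact_closedBall 0 _).of_isClosed_subset (isClosed_box D) box_subset_closedBall

theorem hasCompactSupport_of_support_subset_box {A : E3 → ℝ} {D : ℝ}
    (h : Function.support A ⊆ box D) : HasCompactSupport A :=
  HasCompactSupport.of_support_subset_isCompact (isCompact_box D) h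

/-- A continuous function that vanishes outside the closed box vanishes outside the half-open
box. -/
theorem mem_Ico_of_ne_zero {A : E3 → ℝ} {D : ℝ} (hA : Continuous A)
    (h : Function.support A ⊆ box D) {y : E3} (hy : A y ≠ 0) (k : Fin 3) :
    y k ∈ Set.Ico (-D) D := by
  refine ⟨(h hy k).1, ?_⟩
  -- With y_k ≥ D, the open support would contain points beyond the face of the box.
  have hopen : IsOpen (Function.support A) := hA.isOpen_support
  obtain ⟨ε, hε, hb⟩ := Metric.isOpen_iff.1 hopen y hy
  have : y + EuclideanSpace.single k (ε / 2) ∈ box D := h (hb (by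
    rw [Metric.mem_ball, dist_eq_norm, add_sub_cancel_left, PiLp.norm_single,
      Real.norm_of_nonneg (by positivity)]
    linarith))
  have := (this k).2
  simp at this
  linarith

/-- Comparison of the integrand and its value at the center of a subdivision box. -/
theorem abs_inv_norm_mul_sub_le {A : E3 → ℝ} {K M h r : ℝ} (hM : ∀ y, |A y| ≤ M) (hK0 : 0 ≤ K)
    (hK : ∀ y z, |A y - A z| ≤ K * ‖y - z‖) (hh : 0 < h) (hr : 0 < r) {x y p : E3}
    (hyp : ‖y - p‖ ≤ h) (hxp : r ≤ ‖x - p‖) (hh1 : 3 * h ≤ 1) :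
    |‖x - y‖⁻¹ * A y - ‖x - p‖⁻¹ * A p| ≤
      4 * (M + K) * h +
      (Metric.ball x 1).indicator (fun y => (5 * M + 2 * K) * h * (‖x - y‖ ^ 2)⁻¹) y +
      (Metric.ball x (3 * h)).indicator (fun _ => M / r) y := by
  have hM0 : 0 ≤ M := (abs_nonneg _).trans (hM x)
  have hxp0 : 0 < ‖x - p‖ := hr.trans_le hxp
  have hpx : ‖x - p‖ ≤ ‖x - y‖ + ‖y - p‖ := by
    simpa using norm_add_le (x - y) (y - p)
  have hxy : ‖x - y‖ ≤ ‖x - p‖ + ‖y - p‖ := by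
    simpa [norm_sub_rev] using norm_sub_le (x - p) (y - p)
  have hmem : ∀ s, y ∈ Metric.ball x s ↔ ‖x - y‖ < s := fun s => by
    rw [Metric.mem_ball', dist_eq_norm]
  -- Far from the center the distances to y and p are comparable, and the variation of the kernel
  -- costs h|x - y|⁻². Near it no cancellation is used: |x - y|⁻¹ ≤ 3h|x - y|⁻² and |x - p|⁻¹ ≤ 1/r.
  -- The condition 3h ≤ 1 puts the near case inside the unit ball.
  rcases le_or_gt (2 * h) ‖x - p‖ with hfar | hnear
  · set d := ‖x - y‖ with hd
    set e := ‖x - p‖ with he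
    have hd0 : 0 < d := by linarith
    have hinv : e⁻¹ ≤ 3 / 2 * d⁻¹ := by
      rw [← div_eq_mul_inv, le_div_iff₀ hd0, inv_mul_le_iff₀ hxp0]; linarith
    have h1 : |d⁻¹ - e⁻¹| ≤ 3 / 2 * h * (d ^ 2)⁻¹ := by
      rw [inv_sub_inv hd0.ne' hxp0.ne', abs_div, abs_of_pos (mul_pos hd0 hxp0), div_eq_mul_inv,
        mul_inv]
      have : |e - d| ≤ h := by rw [abs_le]; constructor <;> linarith
      calc |e - d| * (d⁻¹ * e⁻¹) ≤ h * (d⁻¹ * (3 / 2 * d⁻¹)) := by gcongr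
        _ = _ := by ring
    have h2 : d⁻¹ ≤ 1 + (d ^ 2)⁻¹ := by
      rw [← inv_pow]; nlinarith [sq_nonneg (d⁻¹ - 1), inv_pos.2 hd0]
    have hmain : |d⁻¹ * A y - e⁻¹ * A p| ≤ 2 * (M + K) * h * (1 + (d ^ 2)⁻¹) := by
      calc |d⁻¹ * A y - e⁻¹ * A p| = |(d⁻¹ - e⁻¹) * A y + e⁻¹ * (A y - A p)| := by congr 1; ring
        _ ≤ |d⁻¹ - e⁻¹| * |A y| + e⁻¹ * |A y - A p| := by
          refine (abs_add_le _ _).trans ?_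
          rw [abs_mul, abs_mul, abs_of_pos (inv_pos.2 hxp0)]
        _ ≤ 3 / 2 * h * (d ^ 2)⁻¹ * M + 3 / 2 * d⁻¹ * (K * h) := by
          gcongr
          · exact hM y
          · exact (hK y p).trans (by gcongr)
        _ ≤ 3 / 2 * h * (1 + (d ^ 2)⁻¹) * M + 3 / 2 * (1 + (d ^ 2)⁻¹) * (K * h) := by
          gcongr
          linarith
        _ = 3 / 2 * ((M + K) * h * (1 + (d ^ 2)⁻¹)) := by ring
        _ ≤ 2 * ((M + K) * h * (1 + (d ^ 2)⁻¹)) := by gcongr; norm_num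
        _ = _ := by ring
    refine hmain.trans ?_
    have hnn : 0 ≤ (Metric.ball x (3 * h)).indicator (fun _ => M / r) y :=
      Set.indicator_nonneg (fun _ _ => by positivity) _
    by_cases hy1 : d < 1
    · rw [Set.indicator_of_mem ((hmem 1).2 hy1)]
      have : 2 * (M + K) * h * (d ^ 2)⁻¹ ≤ (5 * M + 2 * K) * h * (d ^ 2)⁻¹ := by
        gcongr; linarith
      have h0 : 0 ≤ (M + K) * h := by positivity
      linarith
    · rw [Set.indicator_of_notMem (mt (hmem 1).1 hy1)]
      have : (d ^ 2)⁻¹ ≤ 1 := inv_le_one_of_one_le₀ (one_le_pow₀ (not_lt.1 hy1))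
      have h0 : 0 ≤ (M + K) * h := by positivity
      nlinarith
  · have hlt : ‖x - y‖ < 3 * h := by linarith
    rw [Set.indicator_of_mem ((hmem 1).2 (by linarith)), Set.indicator_of_mem ((hmem _).2 hlt)]
    have h1 : ‖x - y‖⁻¹ ≤ 3 * h * (‖x - y‖ ^ 2)⁻¹ := by
      -- At y = x both sides vanish by the convention 0⁻¹ = 0.
      rcases (norm_nonneg (x - y)).eq_or_lt with h0 | h0
      · rw [← h0]; simp
      · rw [← div_eq_mul_inv, le_div_iff₀ (by positivity), sq, inv_mul_cancel_left₀ h0.ne']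
        exact hlt.le
    calc _ ≤ |‖x - y‖⁻¹ * A y| + |‖x - p‖⁻¹ * A p| := abs_sub _ _
      _ ≤ 3 * h * (‖x - y‖ ^ 2)⁻¹ * M + r⁻¹ * M := by
        rw [abs_mul, abs_mul, abs_of_nonneg (inv_nonneg.2 (norm_nonneg _)),
          abs_of_nonneg (inv_nonneg.2 (norm_nonneg _))]
        gcongr
        · exact hM y
        · exact hM p
      _ ≤ _ := by
        have e1 : 3 * h * (‖x - y‖ ^ 2)⁻¹ * M ≤ (5 * M + 2 * K) * h * (‖x - y‖ ^ 2)⁻¹ := by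
          have : 0 ≤ h * (‖x - y‖ ^ 2)⁻¹ := by positivity
          nlinarith
        have e2 : 0 ≤ (M + K) * h := by positivity
        rw [div_eq_inv_mul]
        linarith

/-- The pointwise bound is integrated with h = D/n and r = D/n². Its first two terms give O(h),
since |z|⁻² is locally integrable in dimension three. The third has height M/r on a ball of volume
O(h³), which is again O(1/n). -/
theorem abs_newtonConv_sub_sum_le {A : E3 → ℝ} {D K M : ℝ} (hD : 0 < D) (hA : Continuous A)
    (hsupp : Function.support A ⊆ box D) (hM : ∀ y, |A y| ≤ M) (hK0 : 0 ≤ K)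
    (hK : ∀ y z, |A y - A z| ≤ K * ‖y - z‖) :
    ∃ C : ℝ, ∀ n : ℕ, 1 ≤ n → 3 * (D / n) ≤ 1 → ∀ x ∉ holes D n,
      |newtonConv A x - ∑ i : BoxIndex n, A (center D n i) * (D / n) ^ 3 / ‖x - center D n i‖| ≤
        C / n := by
  set I : ℝ := ∫ z in Metric.ball (0 : E3) 1, (‖z‖ ^ 2)⁻¹ with hI
  set V : ℝ := volume.real (box D) with hV
  set V₁ : ℝ := volume.real (Metric.ball (0 : E3) 1) with hV₁
  refine ⟨D * (4 * (M + K) * V + (5 * M + 2 * K) * I + 27 * M * D * V₁), fun n hn hn3 x hx => ?_⟩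
  have hn' : (0 : ℝ) < n := by exact_mod_cast hn
  set h : ℝ := D / n with hh
  have hh0 : 0 < h := by positivity
  set r : ℝ := D / (n : ℝ) ^ 2 with hr
  have hr0 : 0 < r := by positivity
  have hc := hasCompactSupport_of_support_subset_box hsupp
  -- The Riemann sum is the integral of this step function, so a pointwise comparison of integrands
  -- suffices.
  set F : E3 → ℝ := fun y => ∑ i : BoxIndex n, (subBox D n i).indicator
    (fun _ => ‖x - center D n i‖⁻¹ * A (center D n i)) y with hF
  have hFint : ∀ i : BoxIndex n, Integrable ((subBox D n i).indicator
      fun _ => ‖x - center D n i‖⁻¹ * A (center D n i)) := fun i =>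
    (integrable_indicator_iff (measurableSet_subBox D n i)).2
      (integrableOn_const (by rw [volume_subBox hD.le]; exact ENNReal.ofReal_ne_top))
  have hFsum : ∫ y, F y = ∑ i : BoxIndex n,
      A (center D n i) * h ^ 3 / ‖x - center D n i‖ := by
    rw [integral_finsetSum _ fun i _ => hFint i]
    refine Finset.sum_congr rfl fun i _ => ?_
    rw [integral_indicator (measurableSet_subBox D n i), setIntegral_const, Measure.real,
      volume_subBox hD.le, ENNReal.toReal_ofReal (by positivity), smul_eq_mul]
    ring
  rw [← hFsum, newtonConv, ← integral_sub (integrable_inv_norm_sub_mul hA hc x)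
    (integrable_finsetSum _ fun i _ => hFint i)]
  set G₁ : E3 → ℝ := (box D).indicator fun _ => 4 * (M + K) * h with hG₁
  set G₂ : E3 → ℝ := (Metric.ball x 1).indicator
    fun y => (5 * M + 2 * K) * h * (‖x - y‖ ^ 2)⁻¹ with hG₂
  set G₃ : E3 → ℝ := (Metric.ball x (3 * h)).indicator fun _ => M / r with hG₃
  have hM0 : 0 ≤ M := (abs_nonneg _).trans (hM x)
  have i₁ : Integrable G₁ := (integrable_indicator_iff (isClosed_box D).measurableSet).2
    (integrableOn_const (isCompact_box D).measure_lt_top.ne)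
  have hq : IntegrableOn (fun y => (‖x - y‖ ^ 2)⁻¹) (Metric.ball x 1) :=
    ((LocallyIntegrable.comp_sub_left locallyIntegrable_inv_norm_sq x).integrableOn_isCompact
      (isCompact_closedBall x 1)).mono_set Metric.ball_subset_closedBall
  have i₂ : Integrable G₂ := (integrable_indicator_iff measurableSet_ball).2 (hq.const_mul _)
  have i₃ : Integrable G₃ := (integrable_indicator_iff measurableSet_ball).2
    (integrableOn_const measure_ball_lt_top.ne)
  have hbound : ∀ y, ‖‖x - y‖⁻¹ * A y - F y‖ ≤ G₁ y + G₂ y + G₃ y := fun y => by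
    have n2 : 0 ≤ G₂ y := Set.indicator_nonneg (fun _ _ => by positivity) _
    have n3 : 0 ≤ G₃ y := Set.indicator_nonneg (fun _ _ => by positivity) _
    have n1 : 0 ≤ G₁ y := Set.indicator_nonneg (fun _ _ => by positivity) _
    by_cases hy : ∃ i, y ∈ subBox D n i
    · obtain ⟨i, hi⟩ := hy
      have hFy : F y = ‖x - center D n i‖⁻¹ * A (center D n i) := by
        rw [hF]
        simp only
        rw [Finset.sum_eq_single i, Set.indicator_of_mem hi]
        · intro j _ hji
          exact Set.indicator_of_notMem (fun hj => hji (eq_of_mem_subBox hD hn hj hi)) _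
        · simp
      rw [hFy, Real.norm_eq_abs, hG₁, Set.indicator_of_mem (subBox_subset_box hD hn i hi)]
      exact abs_inv_norm_mul_sub_le hM hK0 hK hh0 hr0 (norm_sub_center_le hD.le hi)
        (notMem_holes.1 hx i) hn3
    · have hA0 : A y = 0 := by
        by_contra hA0
        exact hy (exists_mem_subBox hD hn fun k => mem_Ico_of_ne_zero hA hsupp hA0 k)
      have hF0 : F y = 0 := Finset.sum_eq_zero fun i _ =>
        Set.indicator_of_notMem (fun hi => hy ⟨i, hi⟩) _
      rw [hA0, hF0]
      simp only [mul_zero, sub_zero, norm_zero]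
      linarith
  have hle := norm_integral_le_of_norm_le ((i₁.add i₂).add i₃) (ae_of_all _ hbound)
  have i₁₂ : Integrable fun y => G₁ y + G₂ y := i₁.add i₂
  have hsum : ∫ y, (G₁ + G₂ + G₃) y = 4 * (M + K) * h * V + (5 * M + 2 * K) * h * I +
      M / r * (27 * h ^ 3 * V₁) := by
    simp only [Pi.add_apply]
    rw [integral_add i₁₂ i₃, integral_add i₁ i₂, hG₁, hG₂, hG₃,
      integral_indicator (isClosed_box D).measurableSet, integral_indicator measurableSet_ball,
      integral_indicator measurableSet_ball, setIntegral_const, setIntegral_const,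
      integral_const_mul]
    have e1 : ∫ y in Metric.ball x 1, (‖x - y‖ ^ 2)⁻¹ = I := by
      rw [hI, ← integral_indicator measurableSet_ball, ← integral_indicator measurableSet_ball,
        ← integral_sub_left_eq_self (fun z => (Metric.ball (0 : E3) 1).indicator
          (fun z => (‖z‖ ^ 2)⁻¹) z) volume x]
      refine integral_congr_ae (ae_of_all _ fun y => ?_)
      simp [Set.indicator, dist_eq_norm, norm_sub_rev]
    have e2 : volume.real (Metric.ball x (3 * h)) = 27 * h ^ 3 * V₁ := by
      rw [hV₁, Measure.real, Measure.addHaar_ball _ _ (by positivity), ENNReal.toReal_mul,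
        ENNReal.toReal_ofReal (by positivity), finrank_E3, Measure.real]
      ring
    rw [e1, e2, ← hV]
    simp only [smul_eq_mul]
    ring
  refine hle.trans (le_of_eq ?_)
  change ∫ y, (G₁ + G₂ + G₃) y = _
  rw [hsum, hr, hh]
  field_simp

/-! ### Convergence of the perforated balls -/

theorem abs_toReal_sub_le {a b : ENNReal} {c : ℝ} (ha : a ≠ ⊤) (hb : b ≠ ⊤) (hc : 0 ≤ c)
    (h1 : a ≤ b + ENNReal.ofReal c) (h2 : b ≤ a + ENNReal.ofReal c) :
    |a.toReal - b.toReal| ≤ c := by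
  have e1 := ENNReal.toReal_mono (ENNReal.add_ne_top.2 ⟨hb, ENNReal.ofReal_ne_top⟩) h1
  have e2 := ENNReal.toReal_mono (ENNReal.add_ne_top.2 ⟨ha, ENNReal.ofReal_ne_top⟩) h2
  rw [ENNReal.toReal_add hb ENNReal.ofReal_ne_top, ENNReal.toReal_ofReal hc] at e1
  rw [ENNReal.toReal_add ha ENNReal.ofReal_ne_top, ENNReal.toReal_ofReal hc] at e2
  rw [abs_le]; constructor <;> linarith

theorem conformalLength_le_mul {f g : E3 → ℝ} {γ γ' : ℝ → E3} {S : Set ℝ} (hS : MeasurableSet S)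
    {c : ℝ} (hc : 0 ≤ c) (hd : ∀ t ∈ S, ‖deriv γ t‖ₑ ≤ ‖deriv γ' t‖ₑ)
    (h : ∀ t ∈ S, Real.sqrt (f (γ t)) ≤ c * Real.sqrt (g (γ' t))) :
    conformalLength f γ S ≤ ENNReal.ofReal c * conformalLength g γ' S := by
  rw [conformalLength, conformalLength, ← lintegral_const_mul' _ _ ENNReal.ofReal_ne_top]
  refine setLIntegral_mono' hS fun t ht => ?_
  rw [← mul_assoc, ← ENNReal.ofReal_mul hc]
  gcongr
  · exact h t ht
  · exact hd t ht

theorem lintegral_enorm_deriv_le_conformalLength {f : E3 → ℝ} {γ : ℝ → E3} {S : Set ℝ}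
    (hS : MeasurableSet S) (h : ∀ t ∈ S, 1 ≤ Real.sqrt (f (γ t))) :
    ∫⁻ t in S, ‖deriv γ t‖ₑ ≤ conformalLength f γ S :=
  setLIntegral_mono' hS fun t ht => le_mul_of_one_le_left bot_le (by simpa using h t ht)

theorem IsPiecewiseSmooth.smul_add {γ : ℝ → E3} (h : IsPiecewiseSmooth γ) (c : ℝ) (v : E3) :
    IsPiecewiseSmooth fun t => c • γ t + v := by
  obtain ⟨hc, P, hP⟩ := h
  exact ⟨(hc.const_smul c).add continuousOn_const, P, fun a b ha hab hb hab' =>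
    ((hP a b ha hab hb hab').const_smul c).add contDiffOn_const⟩

/-- A path of bounded length in the ball can be moved slightly such that it misses the holes. -/
theorem eventually_exists_translate {D R L η : ℝ} (hD : 0 < D) (hR : 0 < R) (hL : 0 ≤ L)
    (hη : 0 < η) (hη1 : η ≤ 1) :
    ∀ᶠ n : ℕ in atTop, ∀ γ : ℝ → E3, IsPiecewiseSmooth γ →
      (∀ t ∈ Set.Icc (0 : ℝ) 1, γ t ∈ Metric.ball 0 R) →
      ∫⁻ t in Set.Icc (0 : ℝ) 1, ‖deriv γ t‖ₑ ≤ ENNReal.ofReal L →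
      ∃ v : E3, ‖v‖ < η * R ∧
        ∀ t ∈ Set.Icc (0 : ℝ) 1, (1 - η) • γ t + v ∈ perforatedBall D R n := by
  -- This is (2n)³(L/r + 1)(2r)³ with r = D/n²: number of holes, number of covering balls, and cubed
  -- radius of the forbidden balls.
  have hlim : Tendsto (fun n : ℕ => 64 * L * D ^ 2 / (n : ℝ) + 64 * D ^ 3 / (n : ℝ) ^ 3) atTop
      (𝓝 0) := by
    have h1 : Tendsto (fun n : ℕ => 64 * L * D ^ 2 / (n : ℝ)) atTop (𝓝 0) :=
      tendsto_const_div_atTop_nhds_zero_nat _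
    have h2 : Tendsto (fun n : ℕ => 64 * D ^ 3 / (n : ℝ) ^ 3) atTop (𝓝 0) :=
      Tendsto.const_div_atTop ((tendsto_pow_atTop three_ne_zero).comp
        tendsto_natCast_atTop_atTop) _
    simpa using h1.add h2
  filter_upwards [hlim.eventually (gt_mem_nhds (by positivity : 0 < (η * R) ^ 3)),
    eventually_ge_atTop 1] with n hn hn1 γ hγ hγR hγL
  classical
  have hn' : (0 : ℝ) < n := by exact_mod_cast hn1
  obtain ⟨T, hT, hcov⟩ := hγ.exists_cover (r := D / (n : ℝ) ^ 2) hL (by positivity) hγL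
  have hη0 : 0 ≤ 1 - η := by linarith
  have hcard : ((T.image fun c => (1 - η) • c).card : ℝ) ≤ L / (D / (n : ℝ) ^ 2) + 1 :=
    le_trans (by exact_mod_cast Finset.card_image_le) hT
  have hsmall : (2 * n : ℝ) ^ 3 * ((T.image fun c => (1 - η) • c).card *
      (2 * (D / (n : ℝ) ^ 2)) ^ 3) < (η * R) ^ 3 := by
    refine lt_of_le_of_lt ?_ hn
    calc _ ≤ (2 * n : ℝ) ^ 3 * ((L / (D / (n : ℝ) ^ 2) + 1) * (2 * (D / (n : ℝ) ^ 2)) ^ 3) := by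
          gcongr
      _ = _ := by field_simp; ring
  have hcov' : ∀ s ∈ (fun t => (1 - η) • γ t) '' Set.Icc (0 : ℝ) 1,
      ∃ c ∈ T.image fun c => (1 - η) • c, ‖s - c‖ ≤ D / (n : ℝ) ^ 2 := by
    rintro _ ⟨t, ht, rfl⟩
    obtain ⟨c, hc, htc⟩ := hcov t ht
    refine ⟨_, Finset.mem_image_of_mem _ hc, ?_⟩
    rw [← smul_sub, norm_smul, Real.norm_of_nonneg hη0]
    exact (mul_le_of_le_one_left (norm_nonneg _) (by linarith)).trans htc
  obtain ⟨v, hv, hmiss⟩ := exists_translate_notMem_holes hD hn1 _ hcov' (by positivity) hsmall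
  refine ⟨v, hv, fun t ht => ⟨?_, hmiss _ ⟨t, ht, rfl⟩⟩⟩
  rw [mem_ball_zero_iff]
  have h1 := mem_ball_zero_iff.1 (hγR t ht)
  -- Shrinking by 1 - η frees a margin ηR, which absorbs v.
  calc ‖(1 - η) • γ t + v‖ ≤ ‖(1 - η) • γ t‖ + ‖v‖ := norm_add_le _ _
    _ = (1 - η) * ‖γ t‖ + ‖v‖ := by rw [norm_smul, Real.norm_of_nonneg hη0]
    _ < R := by nlinarith

theorem riemannianDist_ball_le {R W : ℝ} {f : E3 → ℝ}
    (hW : ∀ z ∈ Metric.ball (0 : E3) R, Real.sqrt (f z) ≤ W) (x y : Metric.ball (0 : E3) R)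
    {a : ℝ} (ha : ‖(x : E3) - y‖ ≤ a) :
    riemannianDist (Metric.ball 0 R) (conformal f) x y ≤ ENNReal.ofReal (W * a) := by
  have hsub := (convex_ball (0 : E3) R).segment_subset x.2 y.2
  refine (riemannianDist_le_of_segment hsub fun z hz => hW z (hsub hz)).trans ?_
  have hW0 : 0 ≤ W := (Real.sqrt_nonneg _).trans (hW x x.2)
  rw [edist_dist, dist_eq_norm, ← ENNReal.ofReal_mul hW0]
  gcongr

/-- The infimum over paths in V includes all paths in U. -/
theorem riemannianDist_le_mul_of_subset {U V : Set E3} (hUV : U ⊆ V) {f g : E3 → ℝ} {c : ℝ}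
    (hc : 0 < c) (h : ∀ z ∈ U, Real.sqrt (f z) ≤ c * Real.sqrt (g z)) (x y : U) :
    riemannianDist V (conformal f) ⟨x, hUV x.2⟩ ⟨y, hUV y.2⟩ ≤
      ENNReal.ofReal c * riemannianDist U (conformal g) x y := by
  have hc0 : ENNReal.ofReal c ≠ 0 := by simpa using hc
  rw [mul_comm, ← ENNReal.div_le_iff hc0 ENNReal.ofReal_ne_top]
  refine le_of_forall_gt fun b hb => ?_
  obtain ⟨γ, h1, h2, h3, h4, h5⟩ := exists_path_of_riemannianDist_lt hb
  refine lt_of_le_of_lt ?_ h5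
  rw [ENNReal.div_le_iff hc0 ENNReal.ofReal_ne_top, mul_comm]
  exact (riemannianDist_le h1 (fun t ht => hUV (h2 t ht)) h3 h4).trans
    (conformalLength_le_mul measurableSet_Icc hc.le (fun _ _ => le_rfl) fun t ht => h _ (h2 t ht))

/-- If the conformal factors on the perforated balls converge uniformly, the distances converge
uniformly, and the perforated balls become dense. -/
theorem eventually_riemannianDist_perforatedBall {D R : ℝ} (hD : 0 < D)
    (hR : Real.sqrt 3 * D < R) {f : E3 → ℝ} {fn : ℕ → E3 → ℝ} (hf : Continuous f)
    (hf1 : ∀ x, 1 ≤ Real.sqrt (f x)) (hfn1 : ∀ n x, 1 ≤ Real.sqrt (fn n x))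
    (hconv : ∀ ε > 0, ∀ᶠ n in atTop, ∀ x ∈ perforatedBall D R n,
      |Real.sqrt (fn n x) - Real.sqrt (f x)| ≤ ε) {ε : ℝ} (hε : 0 < ε) :
    ∀ᶠ n in atTop,
      (∀ x y : perforatedBall D R n,
        riemannianDist (perforatedBall D R n) (conformal (fn n)) x y ≤
          riemannianDist (Metric.ball 0 R) (conformal f) ⟨x, x.2.1⟩ ⟨y, y.2.1⟩ + ENNReal.ofReal ε ∧
        riemannianDist (Metric.ball 0 R) (conformal f) ⟨x, x.2.1⟩ ⟨y, y.2.1⟩ ≤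
          riemannianDist (perforatedBall D R n) (conformal (fn n)) x y + ENNReal.ofReal ε) ∧
      ∀ x : Metric.ball (0 : E3) R, ∃ y : perforatedBall D R n,
        riemannianDist (Metric.ball 0 R) (conformal f) x ⟨y, y.2.1⟩ ≤ ENNReal.ofReal ε := by
  have hR0 : 0 < R := lt_of_le_of_lt (by positivity) hR
  have hw : Continuous fun x => Real.sqrt (f x) := hf.sqrt
  obtain ⟨W, hW⟩ : ∃ W, ∀ x ∈ Metric.closedBall (0 : E3) R, Real.sqrt (f x) ≤ W := by
    obtain ⟨W, hW⟩ := ((isCompact_closedBall (0 : E3) R).image hw).bddAbove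
    exact ⟨W, fun x hx => hW ⟨x, hx, rfl⟩⟩
  have hWb : ∀ x ∈ Metric.ball (0 : E3) R, Real.sqrt (f x) ≤ W := fun x hx =>
    hW x (Metric.ball_subset_closedBall hx)
  have hW1 : 1 ≤ W := (hf1 0).trans (hWb 0 (Metric.mem_ball_self hR0))
  set Λ : ℝ := W * (2 * R) with hΛ
  have hΛ0 : 0 < Λ := by positivity
  have hdΛ : ∀ x y : Metric.ball (0 : E3) R,
      riemannianDist (Metric.ball 0 R) (conformal f) x y ≤ ENNReal.ofReal Λ := fun x y => by
    refine riemannianDist_ball_le hWb x y ((norm_sub_le _ _).trans ?_)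
    linarith [mem_ball_zero_iff.1 x.2, mem_ball_zero_iff.1 y.2]
  -- The upper estimate will cost τ(2Λ + 5), with Λ a bound for the diameter of the limit. It bounds
  -- the perforated distances by 3Λ + 5, so the factor 1 + τ in the lower estimate costs τ(3Λ + 5).
  set τ : ℝ := min 1 (ε / (3 * Λ + 5)) with hτ
  have hτ0 : 0 < τ := lt_min one_pos (by positivity)
  have hτ1 : τ ≤ 1 := min_le_left _ _
  have hτε : τ * (3 * Λ + 5) ≤ ε := (le_div_iff₀ (by positivity)).1 (min_le_right _ _)
  obtain ⟨ρ, hρ0, hρ⟩ := Metric.uniformContinuousOn_iff.1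
    ((isCompact_closedBall (0 : E3) R).uniformContinuousOn_of_continuous hw.continuousOn) τ hτ0
  -- Points will move by at most 2ηR, which must be less than ρ. The detours have scale l = 3ηR, the
  -- third ηR being reserved for the box side D/n; they must stay in B(0,R) and have length at most
  -- τ.
  obtain ⟨η, hη0, hη1, hηρ, hηR, hητ⟩ : ∃ η : ℝ, 0 < η ∧ η ≤ 1 ∧ 2 * (η * R) < ρ ∧
      Real.sqrt 3 * D + 5 * (3 * (η * R)) < R ∧ (W + 1) * (6 * (3 * (η * R))) ≤ τ := by
    have e1 : ∀ᶠ η : ℝ in 𝓝[>] 0, η ≤ 1 :=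
      nhdsWithin_le_nhds (eventually_le_nhds one_pos)
    have lim : ∀ (F : ℝ → ℝ) (b : ℝ), Continuous F → F 0 < b → ∀ᶠ η in 𝓝[>] (0 : ℝ), F η < b :=
      fun F b hF h => nhdsWithin_le_nhds (hF.continuousAt.eventually_lt_const h)
    have e2 := lim (fun η => 2 * (η * R)) ρ (by fun_prop) (by simpa using hρ0)
    have e3 := lim (fun η => Real.sqrt 3 * D + 5 * (3 * (η * R))) R (by fun_prop)
      (by simpa using hR)
    have e4 := lim (fun η => (W + 1) * (6 * (3 * (η * R)))) τ (by fun_prop) (by simpa using hτ0)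
    obtain ⟨η, h1, h2, h3, h4, h5⟩ :=
      (e1.and (e2.and (e3.and (e4.and self_mem_nhdsWithin)))).exists
    exact ⟨η, h5, h1, h2, h3, h4.le⟩
  have hηR0 : 0 < η * R := by positivity
  have hDn : ∀ᶠ n : ℕ in atTop, D / (n : ℝ) < η * R :=
    (tendsto_const_div_atTop_nhds_zero_nat D).eventually (gt_mem_nhds hηR0)
  filter_upwards [eventually_exists_translate hD hR0 (by linarith : 0 ≤ Λ + 1) hη0 hη1, hconv τ hτ0,
    hDn, eventually_ge_atTop 2] with n htr hcn hDn hn2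
  have hmove : ∀ {z v : E3}, z ∈ Metric.ball (0 : E3) R → ‖v‖ < η * R →
      ‖z - ((1 - η) • z + v)‖ ≤ 2 * (η * R) := fun {z v} hz hv => by
    have h1 : z - ((1 - η) • z + v) = η • z - v := by module
    have h2 : ‖η • z‖ ≤ η * R := by
      rw [norm_smul, Real.norm_of_nonneg hη0.le]
      exact mul_le_mul_of_nonneg_left (mem_ball_zero_iff.1 hz).le hη0.le
    rw [h1]
    linarith [norm_sub_le (η • z) v]
  have hwn : ∀ z ∈ perforatedBall D R n, Real.sqrt (fn n z) ≤ W + 1 := fun z hz => by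
    linarith [(abs_le.1 (hcn z hz)).2, hWb z hz.1]
  have hlocal : ∀ x y : perforatedBall D R n, ‖(x : E3) - y‖ ≤ 2 * (η * R) →
      riemannianDist (perforatedBall D R n) (conformal (fn n)) x y ≤ ENNReal.ofReal τ :=
    fun x y hxy => (riemannianDist_perforatedBall_le hD hn2 hwn x y
      (l := 3 * (η * R)) (by linarith) hηR).trans (ENNReal.ofReal_le_ofReal hητ)
  have hupper : ∀ x y : perforatedBall D R n,
      riemannianDist (perforatedBall D R n) (conformal (fn n)) x y ≤
        riemannianDist (Metric.ball 0 R) (conformal f) ⟨x, x.2.1⟩ ⟨y, y.2.1⟩ +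
          ENNReal.ofReal (τ * (2 * Λ + 5)) := fun x y => by
    set d := riemannianDist (Metric.ball 0 R) (conformal f) ⟨x, x.2.1⟩ ⟨y, y.2.1⟩ with hd
    have hdl : d ≤ ENNReal.ofReal Λ := hdΛ _ _
    have hdt : d ≠ ⊤ := (hdl.trans_lt ENNReal.ofReal_lt_top).ne
    obtain ⟨γ, h1, h2, h3, h4, h5⟩ := exists_path_of_riemannianDist_lt
      (ENNReal.lt_add_right hdt (by simpa using hτ0 : ENNReal.ofReal τ ≠ 0))
    have hlen : conformalLength f γ (Set.Icc 0 1) ≤ ENNReal.ofReal (Λ + 1) := by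
      rw [ENNReal.ofReal_add hΛ0.le zero_le_one]
      exact h5.le.trans (add_le_add hdl (ENNReal.ofReal_le_ofReal hτ1))
    obtain ⟨v, hv, hmem⟩ := htr γ h1 h2 ((lintegral_enorm_deriv_le_conformalLength
      measurableSet_Icc fun t _ => hf1 _).trans hlen)
    set γ' : ℝ → E3 := fun t => (1 - η) • γ t + v with hγ'
    have h0I : (0 : ℝ) ∈ Set.Icc (0 : ℝ) 1 := ⟨le_rfl, zero_le_one⟩
    have h1I : (1 : ℝ) ∈ Set.Icc (0 : ℝ) 1 := ⟨zero_le_one, le_rfl⟩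
    have hlen' : conformalLength (fn n) γ' (Set.Icc 0 1) ≤
        ENNReal.ofReal (1 + 2 * τ) * conformalLength f γ (Set.Icc 0 1) := by
      refine conformalLength_le_mul measurableSet_Icc (by positivity) (fun t _ => ?_) fun t ht => ?_
      · have : deriv γ' t = (1 - η) • deriv γ t := by
          rw [hγ', deriv_add_const, deriv_fun_const_smul_field]
        rw [this, enorm_smul]
        refine mul_le_of_le_one_left bot_le ?_
        rw [← ofReal_norm, Real.norm_of_nonneg (by linarith)]
        simpa using hη0.le
      -- Changing the metric and moving the point each cost τ; the additive 2τ becomes the factor 1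
      -- + 2τ because √f ≥ 1.
      · have a1 := (abs_le.1 (hcn _ (hmem t ht))).2
        have a2 := hρ (γ' t) (Metric.ball_subset_closedBall (hmem t ht).1) (γ t)
          (Metric.ball_subset_closedBall (h2 t ht)) (by
            rw [dist_comm, dist_eq_norm]; exact (hmove (h2 t ht) hv).trans_lt hηρ)
        rw [Real.dist_eq] at a2
        have a3 := (abs_lt.1 a2).2
        nlinarith [hf1 (γ t)]
    have t1 := hlocal x ⟨γ' 0, hmem 0 h0I⟩ (by
      have := hmove (h2 0 h0I) hv; rwa [← h3])
    have t3 := hlocal ⟨γ' 1, hmem 1 h1I⟩ y (by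
      have := hmove (h2 1 h1I) hv; rw [norm_sub_rev]; rwa [← h4])
    have t2 := riemannianDist_le (f := fn n) (h1.smul_add (1 - η) v) hmem
      (x := ⟨γ' 0, hmem 0 h0I⟩) (y := ⟨γ' 1, hmem 1 h1I⟩) rfl rfl
    have tri := riemannianDist_triangle (perforatedBall D R n) (fn n)
    calc _ ≤ _ := tri x ⟨γ' 0, hmem 0 h0I⟩ y
      _ ≤ ENNReal.ofReal τ + (ENNReal.ofReal (1 + 2 * τ) * (d + ENNReal.ofReal τ) +
          ENNReal.ofReal τ) :=
        add_le_add t1 ((tri _ ⟨γ' 1, hmem 1 h1I⟩ y).trans (add_le_add (t2.trans (hlen'.trans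
          (mul_le_mul_right h5.le _))) t3))
      _ ≤ d + ENNReal.ofReal (τ * (2 * Λ + 5)) := by
        have hdr : d = ENNReal.ofReal d.toReal := (ENNReal.ofReal_toReal hdt).symm
        have hd0 : 0 ≤ d.toReal := ENNReal.toReal_nonneg
        have hdΛ' : d.toReal ≤ Λ := ENNReal.toReal_le_of_le_ofReal hΛ0.le hdl
        rw [hdr, ← ENNReal.ofReal_add hd0 hτ0.le, ← ENNReal.ofReal_mul (by positivity),
          ← ENNReal.ofReal_add (by positivity) hτ0.le, ← ENNReal.ofReal_add hτ0.le (by positivity),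
          ← ENNReal.ofReal_add hd0 (by positivity)]
        refine ENNReal.ofReal_le_ofReal ?_
        nlinarith
  refine ⟨fun x y => ⟨(hupper x y).trans ?_, ?_⟩, fun x => ?_⟩
  · gcongr
    nlinarith
  · set d := riemannianDist (Metric.ball 0 R) (conformal f) ⟨x, x.2.1⟩ ⟨y, y.2.1⟩ with hd
    set dn := riemannianDist (perforatedBall D R n) (conformal (fn n)) x y with hdn
    have h1 : d ≤ ENNReal.ofReal (1 + τ) * dn := by
      refine riemannianDist_le_mul_of_subset (fun z hz => hz.1) (by positivity) (fun z hz => ?_) x y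
      have := (abs_le.1 (hcn z hz)).1
      nlinarith [hfn1 n z]
    have h2 : dn ≤ ENNReal.ofReal (3 * Λ + 5) := by
      refine ((hupper x y).trans (add_le_add (hdΛ _ _) le_rfl)).trans ?_
      rw [← ENNReal.ofReal_add hΛ0.le (by positivity)]
      refine ENNReal.ofReal_le_ofReal ?_
      nlinarith
    rw [ENNReal.ofReal_add zero_le_one hτ0.le, ENNReal.ofReal_one, add_mul, one_mul] at h1
    refine h1.trans (add_le_add le_rfl ((mul_le_mul_right h2 _).trans ?_))
    rw [← ENNReal.ofReal_mul hτ0.le]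
    exact ENNReal.ofReal_le_ofReal hτε
  -- Density is the translation argument applied to a constant path.
  · obtain ⟨v, hv, hmem⟩ := htr (fun _ => (x : E3)) (isPiecewiseSmooth_of_contDiff contDiff_const)
      (fun _ _ => x.2) (by simp)
    have hm := hmem 0 ⟨le_rfl, zero_le_one⟩
    refine ⟨⟨_, hm⟩, (riemannianDist_ball_le hWb x ⟨_, hm.1⟩ (hmove x.2 hv)).trans
      (ENNReal.ofReal_le_ofReal ?_)⟩
    nlinarith

theorem tendsto_gromovHausdorffEDist_perforatedBall {D R : ℝ} (hD : 0 < D)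
    (hR : Real.sqrt 3 * D < R) {f : E3 → ℝ} {fn : ℕ → E3 → ℝ} (hf : Continuous f)
    (hf1 : ∀ x, 1 ≤ Real.sqrt (f x)) (hfn1 : ∀ n x, 1 ≤ Real.sqrt (fn n x))
    (hconv : ∀ ε > 0, ∀ᶠ n in atTop, ∀ x ∈ perforatedBall D R n,
      |Real.sqrt (fn n x) - Real.sqrt (f x)| ≤ ε) :
    Tendsto (fun n : ℕ => gromovHausdorffEDist
        (riemannianDist (perforatedBall D R n) (conformal (fn n)))
        (riemannianDist (Metric.ball 0 R) (conformal f))) atTop (𝓝 0) := by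
  have hR0 : 0 < R := lt_of_le_of_lt (by positivity) hR
  have hball : ∀ x y : Metric.ball (0 : E3) R,
      riemannianDist (Metric.ball 0 R) (conformal f) x y ≠ ⊤ := fun x y => by
    obtain ⟨W, hW⟩ := ((isCompact_closedBall (0 : E3) R).image hf.sqrt).bddAbove
    exact ((riemannianDist_ball_le (fun z hz => hW ⟨z, Metric.ball_subset_closedBall hz, rfl⟩)
      x y le_rfl).trans_lt ENNReal.ofReal_lt_top).ne
  refine ENNReal.tendsto_nhds_zero.2 fun e he => ?_
  obtain ⟨ε, hε, hεe⟩ : ∃ ε : ℝ, 0 < ε ∧ ENNReal.ofReal (2 * ε) ≤ e := by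
    rcases eq_or_ne e ⊤ with rfl | htop
    · exact ⟨1, one_pos, le_top⟩
    · refine ⟨e.toReal / 2, half_pos (ENNReal.toReal_pos he.ne' htop), ?_⟩
      rw [mul_div_cancel₀ _ two_ne_zero, ENNReal.ofReal_toReal htop]
  filter_upwards [eventually_riemannianDist_perforatedBall hD hR hf hf1 hfn1 hconv hε] with n hn
  obtain ⟨hdist, hdense⟩ := hn
  -- For these large n, finiteness of the perforated distances comes from the comparison with the
  -- ball, where segments give finite distances.
  have hperf : ∀ x y : perforatedBall D R n,
      riemannianDist (perforatedBall D R n) (conformal (fn n)) x y ≠ ⊤ := fun x y =>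
    ((hdist x y).1.trans_lt (ENNReal.add_lt_top.2
      ⟨(hball _ _).lt_top, ENNReal.ofReal_lt_top⟩)).ne
  refine le_trans ?_ hεe
  let mX : MetricSpace (perforatedBall D R n) :=
    riemannianMetricSpace _ (fn n) (fun x _ => hfn1 n x) hperf
  let mY : MetricSpace (Metric.ball (0 : E3) R) :=
    riemannianMetricSpace _ f (fun x _ => hf1 x) hball
  have : Nonempty (perforatedBall D R n) := ⟨(hdense ⟨0, Metric.mem_ball_self hR0⟩).choose⟩
  refine @gromovHausdorffEDist_le _ _ mX mY _ (fun x => ⟨x, x.2.1⟩) ε hε (fun p q => ?_)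
    (fun y => ?_)
  · exact (abs_toReal_sub_le (hperf p q) (hball _ _) hε.le (hdist p q).1 (hdist p q).2).trans
      (by linarith)
  · obtain ⟨x, hx⟩ := hdense y
    exact ⟨x, ENNReal.toReal_le_of_le_ofReal hε.le hx⟩

/-! ### Scalar-flatness of the Riemann sums -/

theorem laplacian_sum_div_norm {ι : Type*} (s : Finset ι) (a : ι → ℝ) (p : ι → E3) {x : E3}
    (h : ∀ i ∈ s, x ≠ p i) :
    ContDiffAt ℝ 2 (fun y => ∑ i ∈ s, a i / ‖y - p i‖) x ∧
      Laplacian.laplacian (fun y => ∑ i ∈ s, a i / ‖y - p i‖) x = 0 := by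
  classical
  induction s using Finset.induction_on with
  | empty => simp [contDiffAt_const]
  | insert j s hj ih =>
    obtain ⟨h1, h2⟩ := ih fun i hi => h i (Finset.mem_insert_of_mem hi)
    have hx := h j (Finset.mem_insert_self j s)
    have h3 : ContDiffAt ℝ 2 (fun y : E3 => ‖y - p j‖⁻¹) x := contDiffAt_inv_norm_sub hx
    have h4 : ContDiffAt ℝ 2 (a j • fun y : E3 => ‖y - p j‖⁻¹) x := contDiffAt_const.smul h3
    have h5 : (fun y => ∑ i ∈ insert j s, a i / ‖y - p i‖) =
        (a j • fun y : E3 => ‖y - p j‖⁻¹) + fun y => ∑ i ∈ s, a i / ‖y - p i‖ := by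
      ext y
      simp [Finset.sum_insert hj, div_eq_mul_inv]
    rw [h5]
    refine ⟨h4.add h1, ?_⟩
    rw [h4.laplacian_add h1, InnerProductSpace.laplacian_smul _ h3, laplacian_inv_norm_sub hx, h2]
    simp

theorem brillLindquistMetric_self (D : ℝ) (n : ℕ) (α : BoxIndex n → ℝ) :
    brillLindquistMetric D n α α = conformal fun x => discretePotential D n α x ^ 4 := by
  simp only [brillLindquistMetric]
  congr 1
  ext x
  ring

theorem one_le_discretePotential {D : ℝ} {n : ℕ} {α : BoxIndex n → ℝ} (hα : ∀ i, 0 ≤ α i) (x : E3) :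
    1 ≤ discretePotential D n α x :=
  le_add_of_nonneg_right (Finset.sum_nonneg fun i _ => div_nonneg (hα i) (norm_nonneg _))

theorem scalarCurvature_brillLindquistMetric {D R : ℝ} (hD : 0 < D) {n : ℕ} (hn : 1 ≤ n)
    {α : BoxIndex n → ℝ} (hα : ∀ i, 0 ≤ α i) {x : E3} (hx : x ∈ perforatedBall D R n) :
    scalarCurvature (brillLindquistMetric D n α α) x = 0 := by
  have hn' : (0 : ℝ) < n := by exact_mod_cast hn
  have hne : ∀ i ∈ (Finset.univ : Finset (BoxIndex n)), x ≠ center D n i := fun i _ h => by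
    have h1 := notMem_holes.1 hx.2 i
    rw [h, sub_self, norm_zero] at h1
    have : 0 < D / (n : ℝ) ^ 2 := by positivity
    linarith
  obtain ⟨h1, h2⟩ := laplacian_sum_div_norm Finset.univ α (center D n) hne
  have h3 : ContDiffAt ℝ 2 (discretePotential D n α) x := contDiffAt_const.add h1
  have h4 : Laplacian.laplacian (discretePotential D n α) x = 0 := by
    have := (contDiffAt_const (c := (1 : ℝ))).laplacian_add h1
    rw [InnerProductSpace.laplacian_const, h2, Pi.zero_apply, add_zero] at this
    exact this
  rw [brillLindquistMetric_self, scalarCurvature_conformal_pow_four h3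
    (by have := one_le_discretePotential (D := D) hα x; positivity), h4, mul_zero]

theorem sqrt_pow_four (a : ℝ) : Real.sqrt (a ^ 4) = a ^ 2 := by
  rw [show a ^ 4 = (a ^ 2) ^ 2 by ring, Real.sqrt_sq (sq_nonneg _)]

/-- The squares of the Riemann sums converge uniformly outside the holes. -/
theorem eventually_abs_discretePotential_sq_sub_le {A : E3 → ℝ} {D R : ℝ} (hD : 0 < D)
    (hA : ContDiff ℝ 2 A) (hA0 : ∀ x, 0 ≤ A x) (hsupp : Function.support A ⊆ box D) {ε : ℝ}
    (hε : 0 < ε) :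
    ∀ᶠ n : ℕ in atTop, ∀ x ∈ perforatedBall D R n,
      |discretePotential D n (fun i => A (center D n i) * (D / n) ^ 3) x ^ 2 -
        (1 + newtonConv A x) ^ 2| ≤ ε := by
  have hc := hasCompactSupport_of_support_subset_box hsupp
  obtain ⟨M, hM⟩ := hA.continuous.bounded_above_of_compact_support hc
  obtain ⟨K, hK⟩ := ContDiff.lipschitzWith_of_hasCompactSupport hc hA (by norm_num)
  obtain ⟨C, hC⟩ := abs_newtonConv_sub_sum_le (K := K) hD hA.continuous hsupp hM K.2
    fun y z => by simpa [Real.dist_eq, dist_eq_norm] using hK.dist_le_mul y z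
  have hχ : Continuous (newtonConv A) := (contDiff_newtonConv (n := 2) hA hc).continuous
  obtain ⟨B, hB⟩ := ((isCompact_closedBall (0 : E3) R).image hχ).bddAbove
  have hlim : Tendsto (fun n : ℕ => C / (n : ℝ) * (2 + 2 * B + C / n)) atTop (𝓝 0) := by
    have h1 : Tendsto (fun n : ℕ => C / (n : ℝ)) atTop (𝓝 0) :=
      tendsto_const_div_atTop_nhds_zero_nat C
    simpa using h1.mul (h1.const_add (2 + 2 * B))
  have hlim3 : Tendsto (fun n : ℕ => 3 * (D / (n : ℝ))) atTop (𝓝 0) := by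
    simpa using (tendsto_const_div_atTop_nhds_zero_nat D).const_mul 3
  filter_upwards [hlim.eventually (gt_mem_nhds hε), hlim3.eventually (gt_mem_nhds one_pos),
    eventually_ge_atTop 1] with n h1 h3 hn x hx
  have hx' := hC n hn h3.le x hx.2
  have hχ0 : 0 ≤ newtonConv A x := newtonConv_nonneg hA0 x
  have hχB : newtonConv A x ≤ B := hB ⟨x, Metric.ball_subset_closedBall hx.1, rfl⟩
  have hpos : 1 ≤ discretePotential D n (fun i => A (center D n i) * (D / n) ^ 3) x :=
    one_le_discretePotential (fun i => mul_nonneg (hA0 _) (by positivity)) x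
  rw [discretePotential] at hpos ⊢
  set s : ℝ := ∑ i : BoxIndex n, A (center D n i) * (D / n) ^ 3 / ‖x - center D n i‖
  set u : ℝ := newtonConv A x
  have hus := abs_le.1 hx'
  -- The second factor stays bounded because u ≤ B and s ≤ u + C/n.
  calc |(1 + s) ^ 2 - (1 + u) ^ 2| = |u - s| * |2 + u + s| := by
        rw [← abs_mul, ← abs_neg]; congr 1; ring
    _ ≤ C / n * (2 + 2 * B + C / n) := by
        rw [abs_of_nonneg (by linarith : 0 ≤ 2 + u + s)]
        have : 0 ≤ C / (n : ℝ) := (abs_nonneg _).trans hx'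
        exact mul_le_mul hx' (by linarith) (by linarith) this
    _ ≤ ε := h1.le

end BLR

end

/-! ### Assembly of the theorem -/

theorem mainTheorem7 (D R : ℝ) (hD : 0 < D) (hR : Real.sqrt 3 * D < R)
    (A : BLR.E3 → ℝ) (hA_smooth : ContDiff ℝ ∞ A) (hA_nonneg : ∀ x, 0 ≤ A x)
    (hA_supp : Function.support A ⊆ BLR.box D) (hA_ne : A ≠ 0) :
    (∃! χ : BLR.E3 → ℝ, BLR.IsPotential A χ) ∧
    ∀ χ : BLR.E3 → ℝ, BLR.IsPotential A χ →
      -- the limit metric is a smooth Riemannian metric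
      (ContDiff ℝ ∞ χ ∧ ∀ x, 0 < χ x) ∧
      -- scalar-flat Brill-Lindquist-Riemann sums with no charge that converge to it
      (∃ α : (n : ℕ) → BLR.BoxIndex n → ℝ, BLR.IsAdmissible D A α ∧
        (∀ n : ℕ, 1 ≤ n → ∀ x ∈ BLR.perforatedBall D R n,
          BLR.scalarCurvature (BLR.brillLindquistMetric D n (α n) (α n)) x = 0) ∧
        Tendsto (fun n : ℕ => BLR.gromovHausdorffEDist
            (BLR.riemannianDist (BLR.perforatedBall D R n)
              (BLR.brillLindquistMetric D n (α n) (α n)))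
            (BLR.riemannianDist (Metric.ball 0 R) (BLR.conformal fun x => χ x ^ 4)))
          atTop (𝓝 0)) ∧
      -- the scalar curvature of the limit
      (∀ x ∈ Metric.ball (0 : BLR.E3) R,
        BLR.scalarCurvature (BLR.conformal fun y => χ y ^ 4) x =
          32 * Real.pi * (χ x ^ 5)⁻¹ * A x) ∧
      ∃ x ∈ Metric.ball (0 : BLR.E3) R,
        BLR.scalarCurvature (BLR.conformal fun y => χ y ^ 4) x ≠ 0 := by
  have hc := BLR.hasCompactSupport_of_support_subset_box hA_supp
  have hA2 : ContDiff ℝ 2 A := contDiff_infty.1 hA_smooth 2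
  have hpot := BLR.isPotential_newtonConv hA2 hc
  refine ⟨⟨_, hpot, fun χ hχ => hχ.unique hpot⟩, fun χ hχ => ?_⟩
  obtain rfl : χ = fun x => 1 + BLR.newtonConv A x := hχ.unique hpot
  have hχ1 : ∀ x, 1 ≤ 1 + BLR.newtonConv A x := fun x =>
    le_add_of_nonneg_right (BLR.newtonConv_nonneg hA_nonneg x)
  have hscal : ∀ x, BLR.scalarCurvature (BLR.conformal fun y => (1 + BLR.newtonConv A y) ^ 4) x =
      32 * Real.pi * ((1 + BLR.newtonConv A x) ^ 5)⁻¹ * A x := fun x => by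
    rw [BLR.scalarCurvature_conformal_pow_four hχ.1.contDiffAt
      (by have := hχ1 x; positivity), hχ.2.1]
    ring
  -- The parameters are the exact Riemann weights, so admissibility holds with bound 0.
  refine ⟨⟨contDiff_const.add (BLR.contDiff_newtonConv hA_smooth hc), fun x =>
    zero_lt_one.trans_le (hχ1 x)⟩, ⟨fun n i => A (BLR.center D n i) * (D / n) ^ 3,
    ⟨fun n i => mul_nonneg (hA_nonneg _) (by positivity), 0, fun n _ i => by simp⟩,
    fun n hn x hx => ?_, ?_⟩, fun x _ => hscal x, ?_⟩
  · exact BLR.scalarCurvature_brillLindquistMetric hD hn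
      (fun i => mul_nonneg (hA_nonneg _) (by positivity)) hx
  · simp only [BLR.brillLindquistMetric_self]
    refine BLR.tendsto_gromovHausdorffEDist_perforatedBall hD hR (hχ.1.continuous.pow 4)
      (fun x => ?_) (fun n x => ?_) fun ε hε => ?_
    · rw [BLR.sqrt_pow_four]
      exact one_le_pow₀ (hχ1 x)
    · rw [BLR.sqrt_pow_four]
      exact one_le_pow₀ (BLR.one_le_discretePotential
        (fun i => mul_nonneg (hA_nonneg _) (by positivity)) x)
    · simp only [BLR.sqrt_pow_four]
      exact BLR.eventually_abs_discretePotential_sq_sub_le hD hA2 hA_nonneg hA_supp hε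
  · obtain ⟨x, hx⟩ := Function.ne_iff.1 hA_ne
    -- A point where A is nonzero has norm at most √3 D < R, so the curvature is nonzero inside the
    -- ball.
    have hxb := BLR.box_subset_closedBall (hA_supp hx)
    refine ⟨x, Metric.closedBall_subset_ball hR hxb, ?_⟩
    rw [hscal]
    have := hχ1 x
    have := Real.pi_pos
    have hx' : A x ≠ 0 := hx
    positivity
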